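/- **Setting.** Let $(X,d)$ be a metric space in which every ball has compact closure, and let $\mu$ be a Radon measure with full support on $X$ that is Ahlfors $d_H$-regular: $c_1 r^{d_H}\le\mu(B(x,r))\le c_2 r^{d_H}$ for all $x\in X$, $r>0$, with $d_H,c_1,c_2\in(0,\infty)$. Let $(\mathcal E,\mathcal F)$ be a regular, strongly local Dirichlet form on $L^2(X,\mu)$ whose heat semigroup $\{P_t\}$ has a heat kernel $p_t(x,y)$ that is continuous in $(x,y)$ for each $t>0$ and satisfies, for some $d_W\in[2,\infty)$ and $c_3,c_4,c_5,c_6\in(0,\infty)$, $$c_5t^{-d_H/d_W}\exp\Bigl(-c_6\bigl(\tfrac{d(x,y)^{d_W}}{t}\bigr)^{\frac1{d_W-1}}\Bigr)\le p_t(x,y)\le c_3t^{-d_H/d_W}\exp\Bigl(-c_4\bigl(\tfrac{d(x,y)^{d_W}}{t}\bigr)^{\frac1{d_W-1}}\Bigr)$$ for every $t>0$ and $\mu\times\mu$-a.e. $(x,y)$. For $\lambda>0$ let $KS^{\lambda,1}(X)$ be the set of $f\in L^1(X,\mu)$ with $$\limsup_{r\to0^+}\int_X\int_{B(x,r)}\frac{|f(y)-f(x)|}{r^\lambda\mu(B(x,r))}\,d\mu(y)\,d\mu(x)<\infty,$$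 let $\lambda_1^\#$ be the supremum of all $\lambda>0$ such that $KS^{\lambda,1}(X)$ contains functions that are not a.e. constant, and let $BV(X)=KS^{\lambda_1^\#,1}(X)$. Assume that, with $\kappa:=d_W-\lambda_1^\#$, one has $0<\kappa<d_W$ and the weak Bakry–Émery condition $wBE(\kappa)$ holds: there is a constant $C_0>0$ with $$|P_tg(x)-P_tg(y)|\le C_0\,\frac{d(x,y)^\kappa}{t^{\kappa/d_W}}\,\|g\|_{L^\infty(X,\mu)}\qquad\text{for all } t>0,\ g\in L^\infty(X,\mu),\ x,y\in X,$$ where $P_tg(x)=\int_Xp_t(x,z)g(z)\,d\mu(z)$. For $f\in L^1(X,\mu)$ and $r>0$ put $$\mathcal M_rf(y)=\frac1{r^{d_H+d_W-\kappa}}\int_{B(y,r)}|f(x)-f(y)|\,d\mu(x).$$ A *BV measure* of $f$ is here any Radon measure $\gamma_f$ for which there is a sequence $r_n\searrow0$ with $\int_X g\,\mathcal M_{r_n}f\,d\mu\to\int_X g\,d\gamma_f$ for every $g\in C_0(X)$ (in particular those that also have total mass $\gamma_f(X)=\mathbf{Var}(f)$). The *$\liminf$ measure* (Sion) of the family $(\mathcal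 M_rf\,d\mu)_{r>0}$ is $$\underline\gamma_f(A)=\inf_{\substack{U\text{ open}\\A\subset U}}\ \sup_{\substack{K\text{ compact}\\K\subset U}}\ \inf\Bigl\{\sum_i\liminf_{r\to0^+}\int_{U_i}\mathcal M_rf\,d\mu:\ U_i\text{ open},\ K\subset\bigcup_iU_i\Bigr\},$$ with countable covers $(U_i)$. The *energy measure* of $f\in\mathcal F\cap L^\infty(X,\mu)$ is the unique Radon measure $\nu_f$ with $\int_X\phi\,d\nu_f=\mathcal E(f\phi,f)-\frac12\mathcal E(\phi,f^2)$ for all $\phi\in\mathcal F\cap C_c(X)$. **Theorem.** There is a constant $C>0$ such that every $f\in BV(X)\cap L^2(X,\mu)$ that is Hölder continuous with exponent $\kappa$ has the following properties: $f\in\mathcal F\cap L^\infty(X,\mu)$; its energy measure $\nu_f$ exists, is unique, and is absolutely continuous with respect to every BV measure of $f$; and $$\nu_f(A)\le C\,\|f\|_{\infty,\kappa}\,\underline\gamma_f(A)\qquad\text{for every Borel set } A\subset X,$$ where $\|f\|_{\infty,\kappa}=\sup_{x\ne y}|f(x)-f(y)|/d(x,y)^\kappa$. The constant $C$ does not depend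 on $f$. -/

import Mathlib

open MeasureTheory Filter Topology Set
open scoped ENNReal NNReal ZeroAtInfty

noncomputable section

namespace BVDirichlet

/-- A Dirichlet form on `L²(X, μ)`: a densely defined, closed, symmetric, nonnegative and
Markovian bilinear form. -/
structure DirichletForm {X : Type*} [MeasurableSpace X] (μ : Measure X) where
  /-- the domain `F` of the form -/
  domain : Submodule ℝ (Lp ℝ 2 μ)
  /-- the form `E` -/
  form : domain →ₗ[ℝ] domain →ₗ[ℝ] ℝ
  symm : ∀ u v : domain, form u v = form v u
  nonneg : ∀ u : domain, 0 ≤ form u u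
  dense : Dense (domain : Set (Lp ℝ 2 μ))
  /-- `F` is complete for the norm `(‖u‖² + E(u, u))^{1/2}` -/
  closed : ∀ u : ℕ → domain,
    (∀ ε > 0, ∃ N : ℕ, ∀ m ≥ N, ∀ n ≥ N,
      ‖((u m - u n : domain) : Lp ℝ 2 μ)‖ ^ 2 + form (u m - u n) (u m - u n) < ε) →
    ∃ v : domain, Tendsto
      (fun n => ‖((u n - v : domain) : Lp ℝ 2 μ)‖ ^ 2 + form (u n - v) (u n - v)) atTop (𝓝 0)
  /-- the unit contraction `(u ∨ 0) ∧ 1` operates on the form -/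
  markovian : ∀ u : domain, ∃ v : domain,
    ((v : Lp ℝ 2 μ) : X → ℝ) =ᵐ[μ] (fun x => min (max ((u : Lp ℝ 2 μ) x) 0) 1) ∧
    form v v ≤ form u u

namespace DirichletForm

section Measurable

variable {X : Type*} [MeasurableSpace X] {μ : Measure X}

/-- The function `f` represents an element of the domain `F`. -/
def Mem (E : DirichletForm μ) (f : X → ℝ) : Prop :=
  ∃ h : MemLp f 2 μ, h.toLp f ∈ E.domain

open Classical in
/-- The value `E(f, g)` for functions `f`, `g` that represent elements of the domain
(and `0`, which is never used, for other functions). -/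
def val (E : DirichletForm μ) (f g : X → ℝ) : ℝ :=
  if h : E.Mem f ∧ E.Mem g then
    E.form ⟨h.1.choose.toLp f, h.1.choose_spec⟩ ⟨h.2.choose.toLp g, h.2.choose_spec⟩
  else 0

/-- `(P t)_{t ≥ 0}` is the heat semigroup of `E`: the strongly continuous semigroup of
self-adjoint contractions of `L²(X, μ)` for which the approximating forms
`E_t(u, u) = t⁻¹ ⟨u - P_t u, u⟩` satisfy `F = {u : sup_{t > 0} E_t(u, u) < ∞}` and
`E(u, u) = lim_{t → 0} E_t(u, u)` on `F`. -/
structure IsHeatSemigroup (E : DirichletForm μ) (P : ℝ → Lp ℝ 2 μ →L[ℝ] Lp ℝ 2 μ) : Prop where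
  zero : P 0 = ContinuousLinearMap.id ℝ (Lp ℝ 2 μ)
  add : ∀ s t : ℝ, 0 ≤ s → 0 ≤ t → P (s + t) = (P s).comp (P t)
  contraction : ∀ t : ℝ, 0 ≤ t → ∀ u : Lp ℝ 2 μ, ‖P t u‖ ≤ ‖u‖
  symm : ∀ t : ℝ, 0 ≤ t → ∀ u v : Lp ℝ 2 μ, inner ℝ (P t u) v = inner ℝ u (P t v)
  tendsto_zero : ∀ u : Lp ℝ 2 μ, Tendsto (fun t => P t u) (𝓝[>] 0) (𝓝 u)
  mem_domain_iff : ∀ u : Lp ℝ 2 μ, u ∈ E.domain ↔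
    BddAbove ((fun t : ℝ => t⁻¹ * inner ℝ (u - P t u) u) '' Ioi 0)
  tendsto_form : ∀ u : E.domain,
    Tendsto (fun t : ℝ => t⁻¹ * inner ℝ ((u : Lp ℝ 2 μ) - P t u) (u : Lp ℝ 2 μ)) (𝓝[>] 0)
      (𝓝 (E.form u u))

end Measurable

section Topological

variable {X : Type*} [TopologicalSpace X] [MeasurableSpace X] {μ : Measure X}

/-- `E` is regular: `F ∩ C_c(X)` is dense in `C_c(X)` for the supremum norm and dense in `F` for
the norm `(‖u‖² + E(u, u))^{1/2}`. -/
structure IsRegular (E : DirichletForm μ) : Prop where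
  dense_continuous : ∀ φ : X → ℝ, Continuous φ → HasCompactSupport φ → ∀ ε > 0,
    ∃ ψ : X → ℝ, Continuous ψ ∧ HasCompactSupport ψ ∧ E.Mem ψ ∧ ∀ x, |φ x - ψ x| < ε
  dense_domain : ∀ u : E.domain, ∀ ε > 0, ∃ v : E.domain,
    (∃ ψ : X → ℝ, Continuous ψ ∧ HasCompactSupport ψ ∧ ((v : Lp ℝ 2 μ) : X → ℝ) =ᵐ[μ] ψ) ∧
    ‖((u - v : E.domain) : Lp ℝ 2 μ)‖ ^ 2 + E.form (u - v) (u - v) < ε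

/-- `E` is strongly local: `E(u, v) = 0` if `u, v ∈ F` have compact supports (contained in `K`,
respectively `L`) and `u` is constant in a neighbourhood `U` of the support of `v`. -/
def IsStronglyLocal (E : DirichletForm μ) : Prop :=
  ∀ (u v : E.domain) (K L U : Set X) (c : ℝ), IsCompact K → IsCompact L → IsOpen U → L ⊆ U →
    (∀ᵐ x ∂μ, x ∉ K → (u : Lp ℝ 2 μ) x = 0) →
    (∀ᵐ x ∂μ, x ∉ L → (v : Lp ℝ 2 μ) x = 0) →
    (∀ᵐ x ∂μ, x ∈ U → (u : Lp ℝ 2 μ) x = c) →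
    E.form u v = 0

/-- `p_t(x, y)` is a continuous heat kernel of `E`: for every `t > 0` it is continuous in `(x, y)`
and it is the integral kernel of the operator `P_t` of the heat semigroup. -/
structure IsContinuousHeatKernel (E : DirichletForm μ) (p : ℝ → X → X → ℝ) : Prop where
  continuous : ∀ t : ℝ, 0 < t → Continuous (fun z : X × X => p t z.1 z.2)
  kernel : ∃ P : ℝ → Lp ℝ 2 μ →L[ℝ] Lp ℝ 2 μ, E.IsHeatSemigroup P ∧
    ∀ t : ℝ, 0 < t → ∀ u : Lp ℝ 2 μ,
      (P t u : X → ℝ) =ᵐ[μ] fun x => ∫ y, p t x y * u y ∂μ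

/-- `ν` is the energy measure of the bounded function `f ∈ F`: the Radon measure with
`∫ φ dν = E(f φ, f) - E(φ, f²) / 2` for all `φ ∈ F ∩ C_c(X)`. -/
structure IsEnergyMeasure [BorelSpace X] (E : DirichletForm μ) (f : X → ℝ) (ν : Measure X) :
    Prop where
  radon : ν.Regular
  mem : E.Mem f
  bounded : MemLp f ⊤ μ
  mem_sq : E.Mem (fun x => f x ^ 2)
  mem_mul : ∀ φ : X → ℝ, Continuous φ → HasCompactSupport φ → E.Mem φ →
    E.Mem (fun x => f x * φ x)
  integral_eq : ∀ φ : X → ℝ, Continuous φ → HasCompactSupport φ → E.Mem φ →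
    ∫ x, φ x ∂ν = E.val (fun x => f x * φ x) f - 1 / 2 * E.val φ (fun x => f x ^ 2)

end Topological

end DirichletForm

section Metric

variable {X : Type*} [MetricSpace X] [MeasurableSpace X]

/-- Ahlfors `dH`-regularity of `μ`. -/
def IsAhlforsRegular (μ : Measure X) (dH : ℝ) : Prop :=
  ∃ c₁ c₂ : ℝ, 0 < c₁ ∧ 0 < c₂ ∧ ∀ (x : X) (r : ℝ), 0 < r →
    ENNReal.ofReal (c₁ * r ^ dH) ≤ μ (Metric.ball x r) ∧
    μ (Metric.ball x r) ≤ ENNReal.ofReal (c₂ * r ^ dH)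

/-- Two-sided sub-Gaussian estimates for `p_t(x, y)`. -/
def SubGaussianEstimates (μ : Measure X) (p : ℝ → X → X → ℝ) (dH dW : ℝ) : Prop :=
  ∃ c₃ c₄ c₅ c₆ : ℝ, 0 < c₃ ∧ 0 < c₄ ∧ 0 < c₅ ∧ 0 < c₆ ∧ ∀ t : ℝ, 0 < t →
    ∀ᵐ z : X × X ∂(μ.prod μ),
      c₅ * t ^ (-dH / dW) * Real.exp (-c₆ * (dist z.1 z.2 ^ dW / t) ^ (1 / (dW - 1)))
        ≤ p t z.1 z.2 ∧
      p t z.1 z.2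
        ≤ c₃ * t ^ (-dH / dW) * Real.exp (-c₄ * (dist z.1 z.2 ^ dW / t) ^ (1 / (dW - 1)))

/-- The weak Bakry-Émery nonnegative curvature condition `wBE(κ)`, where
`P_t g(x) = ∫ p_t(x, z) g(z) dμ(z)` for `g ∈ L^∞(X, μ)`. -/
def WeakBakryEmery (μ : Measure X) (p : ℝ → X → X → ℝ) (dW κ : ℝ) : Prop :=
  0 < κ ∧ κ < dW ∧ ∃ C : ℝ, 0 < C ∧ ∀ t : ℝ, 0 < t → ∀ g : X → ℝ, MemLp g ⊤ μ → ∀ x y : X,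
    |(∫ z, p t x z * g z ∂μ) - ∫ z, p t y z * g z ∂μ|
      ≤ C * (dist x y ^ κ / t ^ (κ / dW)) * (eLpNorm g ⊤ μ).toReal

/-- The Korevaar-Schoen class `KS^{l,1}(X)`. -/
def MemKS (μ : Measure X) (l : ℝ) (f : X → ℝ) : Prop :=
  MemLp f 1 μ ∧
  limsup (fun r : ℝ => ∫⁻ x, ∫⁻ y in Metric.ball x r,
    ‖f y - f x‖ₑ / (ENNReal.ofReal (r ^ l) * μ (Metric.ball x r)) ∂μ ∂μ) (𝓝[>] 0) < ⊤

/-- The critical exponent `λ₁^#`, the supremum (in the extended reals) of the `l > 0` for which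
`KS^{l,1}(X)` contains non-constant functions. -/
def criticalExponent (μ : Measure X) : EReal :=
  sSup ((fun l : ℝ => (l : EReal)) ''
    {l : ℝ | 0 < l ∧ ∃ f : X → ℝ, MemKS μ l f ∧ ¬ ∃ c : ℝ, f =ᵐ[μ] fun _ => c})

/-- The class `BV(X) = KS^{λ₁^#,1}(X)`. -/
def MemBV (μ : Measure X) (f : X → ℝ) : Prop :=
  MemKS μ (criticalExponent μ).toReal f

/-- The function `M_r f (y) = r^{-s} ∫_{B(y,r)} |f(x) - f(y)| dμ(x)`; the exponent of interest is
`s = dH + dW - κ`. -/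
def meanOscillation (μ : Measure X) (s : ℝ) (f : X → ℝ) (r : ℝ) (y : X) : ℝ≥0∞ :=
  ENNReal.ofReal (r ^ (-s)) * ∫⁻ x in Metric.ball y r, ‖f x - f y‖ₑ ∂μ

/-- The measure `M_r f dμ`. -/
def oscillationMeasure (μ : Measure X) (s : ℝ) (f : X → ℝ) (r : ℝ) : Measure X :=
  μ.withDensity (meanOscillation μ s f r)

/-- `γ` is a BV measure of `f`: a Radon measure that is the limit of `M_{r_n} f dμ`, tested
against `C₀(X)`, for some sequence `r_n ↘ 0`. No condition on the total mass of `γ` is imposed,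
so this includes the limits that satisfy in addition `γ(X) = Var f`. -/
def IsBVMeasure [BorelSpace X] (μ : Measure X) (s : ℝ) (f : X → ℝ) (γ : Measure X) : Prop :=
  γ.Regular ∧ ∃ r : ℕ → ℝ, (∀ n, 0 < r n) ∧ Antitone r ∧ Tendsto r atTop (𝓝 0) ∧
    ∀ g : C₀(X, ℝ), Tendsto (fun n => ∫ x, g x ∂(oscillationMeasure μ s f (r n))) atTop
      (𝓝 (∫ x, g x ∂γ))

/-- Sion's `liminf` measure of a family `(m_r)_{r > 0}` of measures, as `r → 0+`. -/
def liminfMeasure (m : ℝ → Measure X) (A : Set X) : ℝ≥0∞ :=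
  ⨅ (U : Set X) (_ : IsOpen U) (_ : A ⊆ U),
    ⨆ (K : Set X) (_ : IsCompact K) (_ : K ⊆ U),
      ⨅ (V : ℕ → Set X) (_ : ∀ i, IsOpen (V i)) (_ : K ⊆ ⋃ i, V i),
        ∑' i, liminf (fun r : ℝ => m r (V i)) (𝓝[>] 0)

end Metric

end BVDirichlet

end

/-! The energy at scale `t` is `(2t)⁻¹ ∫∫ p_t(x,y) (f(y) - f(x))² dμ dμ`. Hölder continuity bounds
one of the two factors `|f(y) - f(x)|` by `H d(x,y)^κ`, and the sub-Gaussian decay turns `p_t d^κ`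
into `t^(κ/dW) p_{Mt}` up to a constant (`KernelComparison.moment`, `heatEnergy_le`). What is left
is an L¹ quantity, the heat oscillation of `f` at time `M t`.

The heat oscillation is compared with `M_r f`, `r = (A t)^(1/dW)`, by absorption. Inside the ball of
radius `r` the kernel is at most a multiple of `t^(-dH/dW)`, which gives `M_r f`; outside, `p_t ≤
(2M)⁻¹ p_{Mt}` (`KernelComparison.tail`). Integrated in `x`, the oscillation is subadditive in time,
by Chapman-Kolmogorov and the triangle inequality, so time `M t` costs at most `M` times time `t`;
the far part is then at most half of the total and is absorbed (`lintegral_heatOscillation_absorb`).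
A Lipschitz weight `φ` makes this local: the heat flow moves `φ` by at most a multiple of `L
t^(1/dW)`, an error that vanishes as `t → 0` because the masses of `M_r f dμ` stay bounded for `f`
in `BV`. With `s = dH + dW - κ` the powers of `t` multiply to exactly `t`, which cancels the
normalisation of the energy (`exists_lintegral_heatEnergy_le`).

Symmetry, Chapman-Kolmogorov and conservativeness of the kernel are derived from the semigroup, the
kernel bounds and `wBE(κ)` (`isTransitionDensity`). The energy measure is the vague limit of the
approximating energy measures; regularity of the form gives its existence and uniqueness
(`exists_limit_measure`, `energyMeasure_unique`). Passing to the limit along an arbitrary filter of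
radii (`EnergyDomination.lintegral_le`) yields both conclusions: a sequence defining a BV measure
gives absolute continuity, and the full limit `r → 0+` gives the bound on open sets that passes to
Sion's measure. -/

namespace BVDirichlet

/-! ### Powers against stretched exponentials -/

/-- A power is dominated by a stretched exponential. -/
theorem exists_rpow_mul_exp_neg_le {a b β : ℝ} (ha : 0 < a) (hb : 0 < b) (hβ : 0 < β) :
    ∃ K : ℝ, 0 < K ∧ ∀ ρ : ℝ, 0 ≤ ρ → ρ ^ a * Real.exp (-b * ρ ^ β) ≤ K := by
  have hq : 0 < a / β := div_pos ha hβ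
  -- With `u = ρ ^ β` and `q = a / β`, the constant comes from raising `v ≤ exp v`, `v = b u / q`,
  -- to the power `q`.
  refine ⟨(a / β / b) ^ (a / β), by positivity, fun ρ hρ => ?_⟩
  have hu : 0 ≤ ρ ^ β := Real.rpow_nonneg hρ _
  have h1 : ρ ^ a = (ρ ^ β) ^ (a / β) := by
    rw [← Real.rpow_mul hρ, mul_div_cancel₀ _ hβ.ne']
  set u := ρ ^ β
  have h2 : b * u / (a / β) ≤ Real.exp (b * u / (a / β)) :=
    (le_add_of_nonneg_right zero_le_one).trans (Real.add_one_le_exp _)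
  have h3 : (b * u / (a / β)) ^ (a / β) ≤ Real.exp (b * u) := by
    refine (Real.rpow_le_rpow (by positivity) h2 hq.le).trans_eq ?_
    rw [← Real.exp_mul, div_mul_cancel₀ _ hq.ne']
  have h4 : u ^ (a / β) = (b * u / (a / β)) ^ (a / β) * (a / β / b) ^ (a / β) := by
    rw [← Real.mul_rpow (by positivity) (by positivity)]
    congr 1
    field_simp
  rw [h1, h4, neg_mul, Real.exp_neg]
  have he := Real.exp_pos (b * u)
  calc _ ≤ Real.exp (b * u) * (a / β / b) ^ (a / β) * (Real.exp (b * u))⁻¹ := by gcongr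
    _ = _ := by field_simp

theorem exists_one_add_rpow_mul_exp_neg_le {a b β : ℝ} (ha : 0 < a) (hb : 0 < b) (hβ : 0 < β) :
    ∃ K : ℝ, 0 < K ∧ ∀ ρ : ℝ, 0 ≤ ρ → (1 + ρ) ^ a * Real.exp (-b * ρ ^ β) ≤ K := by
  obtain ⟨K, hK, h⟩ := exists_rpow_mul_exp_neg_le ha hb hβ
  refine ⟨2 ^ a * (1 + K), by positivity, fun ρ hρ => ?_⟩
  have h1 : (1 + ρ) ^ a ≤ 2 ^ a * (1 + ρ ^ a) := by
    rcases le_total ρ 1 with h1 | h1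
    · calc (1 + ρ) ^ a ≤ 2 ^ a := Real.rpow_le_rpow (by positivity) (by linarith) ha.le
        _ ≤ _ := le_mul_of_one_le_right (by positivity) (by linarith [Real.rpow_nonneg hρ a])
    · calc (1 + ρ) ^ a ≤ (2 * ρ) ^ a := Real.rpow_le_rpow (by positivity) (by linarith) ha.le
        _ = 2 ^ a * ρ ^ a := Real.mul_rpow zero_le_two hρ
        _ ≤ _ := by gcongr; linarith
  have h2 : Real.exp (-b * ρ ^ β) ≤ 1 := by
    rw [Real.exp_le_one_iff]
    have := Real.rpow_nonneg hρ β
    nlinarith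
  have h3 := h ρ hρ
  calc _ ≤ 2 ^ a * (1 + ρ ^ a) * Real.exp (-b * ρ ^ β) := by gcongr
    _ = 2 ^ a * (Real.exp (-b * ρ ^ β) + ρ ^ a * Real.exp (-b * ρ ^ β)) := by ring
    _ ≤ _ := by gcongr

/-! ### Pointwise kernel bounds and comparison of the kernel at times `t` and `M t` -/

section Bounds

variable {X : Type*} [MetricSpace X]

/-- Pointwise two-sided sub-Gaussian bounds, with explicit constants. -/
structure PointwiseBounds (p : ℝ → X → X → ℝ) (dH dW c₃ c₄ c₅ c₆ : ℝ) : Prop where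
  pos₃ : 0 < c₃
  pos₄ : 0 < c₄
  pos₅ : 0 < c₅
  pos₆ : 0 < c₆
  lower : ∀ t : ℝ, 0 < t → ∀ x y : X,
    c₅ * t ^ (-dH / dW) * Real.exp (-c₆ * (dist x y ^ dW / t) ^ (1 / (dW - 1))) ≤ p t x y
  upper : ∀ t : ℝ, 0 < t → ∀ x y : X,
    p t x y ≤ c₃ * t ^ (-dH / dW) * Real.exp (-c₄ * (dist x y ^ dW / t) ^ (1 / (dW - 1)))

/-- Both sides of each estimate are continuous, so the estimates hold on a closed set; since `μ × μ`
has full support, a closed set of full measure is the whole space. -/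
theorem SubGaussianEstimates.pointwise [SecondCountableTopology X] [MeasurableSpace X] [BorelSpace X]
    {μ : Measure X} [SFinite μ] [μ.IsOpenPosMeasure] {p : ℝ → X → X → ℝ} {dH dW : ℝ} (hdW : 2 ≤ dW)
    (hcont : ∀ t : ℝ, 0 < t → Continuous (fun z : X × X => p t z.1 z.2))
    (h : SubGaussianEstimates μ p dH dW) :
    ∃ c₃ c₄ c₅ c₆ : ℝ, PointwiseBounds p dH dW c₃ c₄ c₅ c₆ := by
  obtain ⟨c₃, c₄, c₅, c₆, h₃, h₄, h₅, h₆, h⟩ := h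
  have hβ : 0 ≤ 1 / (dW - 1) := by
    apply div_nonneg zero_le_one; linarith
  have hc : ∀ (c d t : ℝ), Continuous (fun z : X × X =>
      c * t ^ (-dH / dW) * Real.exp (-d * (dist z.1 z.2 ^ dW / t) ^ (1 / (dW - 1)))) := by
    intro c d t
    have h1 : Continuous (fun z : X × X => dist z.1 z.2 ^ dW / t) :=
      (continuous_dist.rpow_const fun _ => Or.inr (by linarith)).div_const _
    have h2 := h1.rpow_const (p := 1 / (dW - 1)) (fun _ => Or.inr hβ)
    fun_prop
  have key : ∀ t : ℝ, 0 < t → ∀ z : X × X,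
      c₅ * t ^ (-dH / dW) * Real.exp (-c₆ * (dist z.1 z.2 ^ dW / t) ^ (1 / (dW - 1)))
        ≤ p t z.1 z.2 ∧
      p t z.1 z.2
        ≤ c₃ * t ^ (-dH / dW) * Real.exp (-c₄ * (dist z.1 z.2 ^ dW / t) ^ (1 / (dW - 1))) := by
    intro t ht z
    have hd := Measure.dense_of_ae (h t ht)
    have hcl : IsClosed {z : X × X |
      c₅ * t ^ (-dH / dW) * Real.exp (-c₆ * (dist z.1 z.2 ^ dW / t) ^ (1 / (dW - 1)))
        ≤ p t z.1 z.2 ∧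
      p t z.1 z.2
        ≤ c₃ * t ^ (-dH / dW) * Real.exp (-c₄ * (dist z.1 z.2 ^ dW / t) ^ (1 / (dW - 1)))} :=
      (isClosed_le (hc _ _ _) (hcont t ht)).inter (isClosed_le (hcont t ht) (hc _ _ _))
    have := hd.closure_eq
    rw [hcl.closure_eq] at this
    exact (this ▸ mem_univ z : z ∈ _)
  exact ⟨c₃, c₄, c₅, c₆, h₃, h₄, h₅, h₆, fun t ht x y => (key t ht (x, y)).1,
    fun t ht x y => (key t ht (x, y)).2⟩

/-- Comparison of the heat kernel with itself at a larger time. -/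
structure KernelComparison (p : ℝ → X → X → ℝ) (dW : ℝ) (M : ℕ) (K b : ℝ) : Prop where
  one_le : 1 ≤ M
  posK : 0 < K
  posb : 0 < b
  nonneg : ∀ t : ℝ, 0 < t → ∀ x y : X, 0 ≤ p t x y
  le : ∀ t : ℝ, 0 < t → ∀ x y : X,
    p t x y ≤ K * Real.exp (-b * (dist x y ^ dW / t) ^ (1 / (dW - 1))) * p (M * t) x y

variable {p : ℝ → X → X → ℝ} {dH dW c₃ c₄ c₅ c₆ : ℝ}

theorem PointwiseBounds.nonneg (h : PointwiseBounds p dH dW c₃ c₄ c₅ c₆) {t : ℝ} (ht : 0 < t)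
    (x y : X) : 0 ≤ p t x y := by
  refine le_trans ?_ (h.lower t ht x y)
  have := h.pos₅
  positivity

theorem PointwiseBounds.le_diag (h : PointwiseBounds p dH dW c₃ c₄ c₅ c₆) {t : ℝ} (ht : 0 < t)
    (x y : X) : p t x y ≤ c₃ * t ^ (-dH / dW) := by
  refine (h.upper t ht x y).trans ?_
  have := h.pos₃
  have h4 := h.pos₄
  refine mul_le_of_le_one_right (by positivity) ?_
  rw [Real.exp_le_one_iff, neg_mul, neg_nonpos]
  positivity

theorem PointwiseBounds.le_near (h : PointwiseBounds p dH dW c₃ c₄ c₅ c₆) (hdW : 2 ≤ dW)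
    {t : ℝ} (ht : 0 < t) {x y : X} (hxy : dist x y ≤ t ^ (1 / dW)) :
    c₅ * t ^ (-dH / dW) * Real.exp (-c₆) ≤ p t x y := by
  refine le_trans ?_ (h.lower t ht x y)
  have h5 := h.pos₅
  have h6 := h.pos₆
  gcongr ?_ * Real.exp ?_
  rw [neg_mul, neg_le_neg_iff]
  refine mul_le_of_le_one_right h6.le (Real.rpow_le_one (by positivity) ?_ ?_)
  · rw [div_le_one ht]
    calc dist x y ^ dW ≤ (t ^ (1 / dW)) ^ dW :=
          Real.rpow_le_rpow dist_nonneg hxy (by linarith)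
      _ = t := by rw [← Real.rpow_mul ht.le, one_div_mul_cancel (by linarith), Real.rpow_one]
  · apply div_nonneg zero_le_one; linarith

/-- Passing from `t` to `M t` divides the lower exponent `c₆ ρ^β` by `M^β`. Once `M^β ≥ 2 c₆ / c₄`,
half of the upper exponential is below the lower exponential at time `M t`; the other half survives
as the gain `exp (-(c₄/2) ρ^β)`. -/
theorem PointwiseBounds.comparison (h : PointwiseBounds p dH dW c₃ c₄ c₅ c₆) (hdW : 2 ≤ dW) :
    ∃ (M : ℕ) (K b : ℝ), KernelComparison p dW M K b := by
  have h3 := h.pos₃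
  have h4 := h.pos₄
  have h5 := h.pos₅
  have h6 := h.pos₆
  set β := 1 / (dW - 1) with hβdef
  have hβ : 0 < β := by apply div_pos zero_lt_one; linarith
  obtain ⟨M, hM1, hM⟩ : ∃ M : ℕ, 1 ≤ M ∧ 2 * c₆ / c₄ ≤ (M : ℝ) ^ β := by
    have h1 := ((tendsto_rpow_atTop hβ).comp tendsto_natCast_atTop_atTop).eventually_ge_atTop
      (2 * c₆ / c₄)
    obtain ⟨M, hM⟩ := ((eventually_ge_atTop 1).and h1).exists
    exact ⟨M, hM⟩
  have hM0 : (0 : ℝ) < M := by exact_mod_cast hM1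
  refine ⟨M, c₃ / (c₅ * (M : ℝ) ^ (-dH / dW)), c₄ / 2, hM1, by positivity, by positivity,
    fun t ht => h.nonneg ht, fun t ht x y => ?_⟩
  set ρ := dist x y ^ dW / t with hρ
  have hρ0 : 0 ≤ ρ := by positivity
  have hl := h.lower (M * t) (by positivity) x y
  have e1 : (dist x y ^ dW / (M * t)) ^ β = ρ ^ β / (M : ℝ) ^ β := by
    rw [← Real.div_rpow hρ0 hM0.le, hρ, div_div, mul_comm t]
  rw [e1, Real.mul_rpow hM0.le ht.le] at hl
  have e2 : c₆ * (ρ ^ β / (M : ℝ) ^ β) ≤ c₄ / 2 * ρ ^ β := by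
    rw [div_le_iff₀ h4] at hM
    rw [← mul_div_assoc, div_le_iff₀ (by positivity)]
    have : 0 ≤ ρ ^ β := by positivity
    nlinarith
  have e3 : c₅ * ((M : ℝ) ^ (-dH / dW) * t ^ (-dH / dW)) * Real.exp (-(c₄ / 2 * ρ ^ β))
      ≤ p (M * t) x y := by
    refine le_trans ?_ hl
    rw [neg_mul]
    gcongr
  refine (h.upper t ht x y).trans ?_
  have e4 : Real.exp (-c₄ * ρ ^ β)
      = Real.exp (-(c₄ / 2) * ρ ^ β) * Real.exp (-(c₄ / 2 * ρ ^ β)) := by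
    rw [← Real.exp_add]; congr 1; ring
  calc _ = c₃ / (c₅ * (M : ℝ) ^ (-dH / dW)) * Real.exp (-(c₄ / 2) * ρ ^ β) *
        (c₅ * ((M : ℝ) ^ (-dH / dW) * t ^ (-dH / dW)) * Real.exp (-(c₄ / 2 * ρ ^ β))) := by
        rw [e4]
        have : (0 : ℝ) < (M : ℝ) ^ (-dH / dW) := by positivity
        field_simp
    _ ≤ _ := by gcongr

variable {M : ℕ} {K b : ℝ}

/-- In terms of `ρ = d^dW / t` the weight is `d^θ = t^(θ/dW) ρ^(θ/dW)`, and the exponential gain of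
the comparison absorbs the power of `ρ`. -/
theorem KernelComparison.moment (h : KernelComparison p dW M K b) (hdW : 2 ≤ dW) {θ : ℝ}
    (hθ : 0 < θ) : ∃ D : ℝ, 0 < D ∧ ∀ t : ℝ, 0 < t → ∀ x y : X,
      p t x y * dist x y ^ θ ≤ D * t ^ (θ / dW) * p (M * t) x y := by
  have hW : 0 < dW := by linarith
  have hβ : 0 < 1 / (dW - 1) := by apply div_pos zero_lt_one; linarith
  obtain ⟨D, hD, hD'⟩ := exists_rpow_mul_exp_neg_le (div_pos hθ hW) h.posb hβ
  have hK := h.posK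
  refine ⟨K * D, by positivity, fun t ht x y => ?_⟩
  have hp : 0 ≤ p (M * t) x y :=
    h.nonneg _ (mul_pos (by exact_mod_cast h.one_le) ht) x y
  have e := hD' (dist x y ^ dW / t) (by positivity)
  have e1 : dist x y ^ θ = t ^ (θ / dW) * (dist x y ^ dW / t) ^ (θ / dW) := by
    rw [Real.div_rpow (by positivity) ht.le, ← Real.rpow_mul dist_nonneg, mul_div_cancel₀ _ hW.ne']
    have : 0 < t ^ (θ / dW) := by positivity
    field_simp
  calc _ ≤ K * Real.exp (-b * (dist x y ^ dW / t) ^ (1 / (dW - 1))) * p (M * t) x y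
        * dist x y ^ θ := by gcongr; exact h.le t ht x y
    _ = K * ((dist x y ^ dW / t) ^ (θ / dW) *
        Real.exp (-b * (dist x y ^ dW / t) ^ (1 / (dW - 1)))) * t ^ (θ / dW) * p (M * t) x y := by
        rw [e1]; ring
    _ ≤ K * D * t ^ (θ / dW) * p (M * t) x y := by gcongr

/-- Beyond distance `(A t)^(1/dW)` one has `ρ ≥ A`, so the gain is at most `K exp (-b A^β)`, which
is small for large `A`, uniformly in `t`. Keeping `p (M * t)` on the right, instead of a pure
exponential, is what allows the far part to be absorbed later. -/
theorem KernelComparison.tail (h : KernelComparison p dW M K b) (hdW : 2 ≤ dW) {ε : ℝ}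
    (hε : 0 < ε) : ∃ A : ℝ, 0 < A ∧ ∀ t : ℝ, 0 < t → ∀ x y : X,
      (A * t) ^ (1 / dW) ≤ dist x y → p t x y ≤ ε * p (M * t) x y := by
  have hW : 0 < dW := by linarith
  have hβ : 0 < 1 / (dW - 1) := by apply div_pos zero_lt_one; linarith
  have hK := h.posK
  have hlim : Tendsto (fun A : ℝ => K * Real.exp (-b * A ^ (1 / (dW - 1)))) atTop (𝓝 (K * 0)) := by
    refine tendsto_const_nhds.mul (Real.tendsto_exp_atBot.comp ?_)
    exact (tendsto_rpow_atTop hβ).const_mul_atTop_of_neg (neg_neg_of_pos h.posb)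
  rw [mul_zero] at hlim
  obtain ⟨A, hA0, hA⟩ := ((eventually_gt_atTop 0).and (hlim.eventually_le_const hε)).exists
  refine ⟨A, hA0, fun t ht x y hxy => (h.le t ht x y).trans ?_⟩
  have hp : 0 ≤ p (M * t) x y :=
    h.nonneg _ (mul_pos (by exact_mod_cast h.one_le) ht) x y
  refine mul_le_mul_of_nonneg_right (le_trans ?_ hA) hp
  have hb := h.posb
  have : A ≤ dist x y ^ dW / t := by
    rw [le_div_iff₀ ht]
    calc A * t = ((A * t) ^ (1 / dW)) ^ dW := by
          rw [← Real.rpow_mul (by positivity), one_div_mul_cancel hW.ne', Real.rpow_one]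
      _ ≤ _ := Real.rpow_le_rpow (by positivity) hxy hW.le
  gcongr K * Real.exp ?_
  rw [neg_mul, neg_mul, neg_le_neg_iff]
  gcongr

end Bounds

/-! ### Bounds on the total mass of the kernel -/

section Volume

variable {X : Type*} [MetricSpace X] [MeasurableSpace X] [BorelSpace X] {μ : Measure X}
  {p : ℝ → X → X → ℝ} {dH dW c₃ c₄ c₅ c₆ : ℝ}

/-- Sum over annuli of width `R = t^(1/dW)`. On the `k`-th one the exponential beats
`(k+1)^(-(dH+2))`, while the volume is of order `((k+1) R)^dH`; the powers of `t` cancel and `∑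
(k+1)^(-2)` remains. -/
theorem PointwiseBounds.lintegral_le (h : PointwiseBounds p dH dW c₃ c₄ c₅ c₆) (hdW : 2 ≤ dW)
    (hdH : 0 < dH) (hμ : IsAhlforsRegular μ dH) :
    ∃ C : ℝ, 0 < C ∧ ∀ t : ℝ, 0 < t → ∀ x : X,
      ∫⁻ y, ENNReal.ofReal (p t x y) ∂μ ≤ ENNReal.ofReal C := by
  obtain ⟨c₁, c₂, hc₁, hc₂, hμ⟩ := hμ
  have hW : 0 < dW := by linarith
  have h3 := h.pos₃
  have hβ : 0 < dW * (1 / (dW - 1)) := by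
    apply mul_pos hW; apply div_pos zero_lt_one; linarith
  have hN : 0 < dH + 2 := by linarith
  obtain ⟨K, hK, hK'⟩ := exists_one_add_rpow_mul_exp_neg_le hN h.pos₄ hβ
  have hsum : Summable (fun k : ℕ => ((k : ℝ) + 1) ^ (-2 : ℝ)) := by
    have := (summable_nat_add_iff 1).2 (Real.summable_nat_rpow.2 (by norm_num : (-2 : ℝ) < -1))
    simpa using this
  have hS0 : 0 < ∑' k : ℕ, ((k : ℝ) + 1) ^ (-2 : ℝ) :=
    hsum.tsum_pos (fun k => by positivity) 0 (by positivity)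
  refine ⟨c₃ * K * 2 ^ (dH + 2) * c₂ * ∑' k : ℕ, ((k : ℝ) + 1) ^ (-2 : ℝ), by positivity,
    fun t ht x => ?_⟩
  set R := t ^ (1 / dW) with hR
  have hR0 : 0 < R := by positivity
  have hRdH : t ^ (-dH / dW) * R ^ dH = 1 := by
    rw [hR, ← Real.rpow_mul ht.le, ← Real.rpow_add ht,
      show -dH / dW + 1 / dW * dH = 0 by ring, Real.rpow_zero]
  have hpt : ∀ y, ENNReal.ofReal (p t x y) ≤ ∑' k : ℕ,
      (Metric.ball x ((k + 1) * R)).indicator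
        (fun _ => ENNReal.ofReal (c₃ * t ^ (-dH / dW) * (K * 2 ^ (dH + 2) *
          ((k : ℝ) + 1) ^ (-(dH + 2))))) y := by
    intro y
    set v := dist x y / R with hv
    have hv0 : 0 ≤ v := by positivity
    -- Only the term of the annulus that contains `y` is needed.
    refine le_trans ?_ (ENNReal.le_tsum ⌊v⌋₊)
    rw [indicator_of_mem]
    · apply ENNReal.ofReal_le_ofReal
      refine (h.upper t ht x y).trans ?_
      gcongr
      have e1 : (dist x y ^ dW / t) ^ (1 / (dW - 1)) = v ^ (dW * (1 / (dW - 1))) := by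
        rw [Real.rpow_mul hv0]
        congr 1
        rw [hv, Real.div_rpow dist_nonneg hR0.le, hR, ← Real.rpow_mul ht.le,
          one_div_mul_cancel hW.ne', Real.rpow_one]
      rw [e1]
      have e2 := hK' v hv0
      have e3 : ((⌊v⌋₊ : ℝ) + 1) ^ (dH + 2) ≤ 2 ^ (dH + 2) * (1 + v) ^ (dH + 2) := by
        rw [← Real.mul_rpow (by positivity) (by positivity)]
        apply Real.rpow_le_rpow (by positivity) _ hN.le
        linarith [Nat.floor_le hv0]
      rw [Real.rpow_neg (by positivity), ← div_eq_mul_inv, le_div_iff₀ (by positivity)]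
      calc _ ≤ Real.exp (-c₄ * v ^ (dW * (1 / (dW - 1)))) * (2 ^ (dH + 2) * (1 + v) ^ (dH + 2)) := by
            gcongr
        _ = (1 + v) ^ (dH + 2) * Real.exp (-c₄ * v ^ (dW * (1 / (dW - 1)))) * 2 ^ (dH + 2) := by ring
        _ ≤ _ := by gcongr
    · rw [Metric.mem_ball']
      have := Nat.lt_floor_add_one v
      rwa [hv, div_lt_iff₀ hR0] at this
  refine (lintegral_mono hpt).trans ?_
  rw [lintegral_tsum (fun k => (measurable_const.indicator measurableSet_ball).aemeasurable)]
  rw [← tsum_mul_left, ENNReal.ofReal_tsum_of_nonneg (fun k => by positivity) (hsum.mul_left _)]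
  refine ENNReal.tsum_le_tsum fun k => ?_
  rw [lintegral_indicator_const measurableSet_ball]
  refine (mul_le_mul_right (hμ x _ (by positivity)).2 _).trans_eq ?_
  rw [← ENNReal.ofReal_mul (by positivity)]
  congr 1
  rw [Real.mul_rpow (by positivity) hR0.le]
  have e : ((k : ℝ) + 1) ^ (-(dH + 2)) * ((k : ℝ) + 1) ^ dH = ((k : ℝ) + 1) ^ (-2 : ℝ) := by
    rw [← Real.rpow_add (by positivity)]; congr 1; ring
  calc _ = c₃ * K * 2 ^ (dH + 2) * c₂ * (t ^ (-dH / dW) * R ^ dH) *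
        (((k : ℝ) + 1) ^ (-(dH + 2)) * ((k : ℝ) + 1) ^ dH) := by ring
    _ = _ := by rw [hRdH, e, mul_one]

theorem PointwiseBounds.le_lintegral (h : PointwiseBounds p dH dW c₃ c₄ c₅ c₆) (hdW : 2 ≤ dW)
    (hμ : IsAhlforsRegular μ dH) :
    ∃ c : ℝ, 0 < c ∧ ∀ t : ℝ, 0 < t → ∀ x : X,
      ENNReal.ofReal c ≤ ∫⁻ y, ENNReal.ofReal (p t x y) ∂μ := by
  obtain ⟨c₁, c₂, hc₁, hc₂, hμ⟩ := hμ
  have h5 := h.pos₅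
  refine ⟨c₅ * Real.exp (-c₆) * c₁, by positivity, fun t ht x => ?_⟩
  have hR0 : 0 < t ^ (1 / dW) := by positivity
  have hRdH : t ^ (-dH / dW) * (t ^ (1 / dW)) ^ dH = 1 := by
    rw [← Real.rpow_mul ht.le, ← Real.rpow_add ht,
      show -dH / dW + 1 / dW * dH = 0 by ring, Real.rpow_zero]
  calc ENNReal.ofReal (c₅ * Real.exp (-c₆) * c₁)
      = ENNReal.ofReal (c₅ * t ^ (-dH / dW) * Real.exp (-c₆)) *
          ENNReal.ofReal (c₁ * (t ^ (1 / dW)) ^ dH) := by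
        rw [← ENNReal.ofReal_mul (by positivity)]
        congr 1
        calc _ = c₅ * Real.exp (-c₆) * c₁ * 1 := by ring
          _ = c₅ * Real.exp (-c₆) * c₁ * (t ^ (-dH / dW) * (t ^ (1 / dW)) ^ dH) := by rw [hRdH]
          _ = _ := by ring
    _ ≤ ENNReal.ofReal (c₅ * t ^ (-dH / dW) * Real.exp (-c₆)) * μ (Metric.ball x (t ^ (1 / dW))) := by
        gcongr; exact (hμ x _ hR0).1
    _ = ∫⁻ y in Metric.ball x (t ^ (1 / dW)),
          ENNReal.ofReal (c₅ * t ^ (-dH / dW) * Real.exp (-c₆)) ∂μ := (setLIntegral_const _ _).symm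
    _ ≤ ∫⁻ y in Metric.ball x (t ^ (1 / dW)), ENNReal.ofReal (p t x y) ∂μ := by
        refine setLIntegral_mono' measurableSet_ball fun y hy => ENNReal.ofReal_le_ofReal ?_
        exact h.le_near hdW ht (Metric.mem_ball'.1 hy).le
    _ ≤ _ := setLIntegral_le_lintegral _ _

end Volume

/-! ### Symmetry, Chapman-Kolmogorov identity and conservativeness of the kernel -/

section Kernel

theorem heat_indicator {X : Type*} [MeasurableSpace X] {μ : Measure X}
    {p : ℝ → X → X → ℝ} {P : ℝ → Lp ℝ 2 μ →L[ℝ] Lp ℝ 2 μ}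
    (hker : ∀ t : ℝ, 0 < t → ∀ u : Lp ℝ 2 μ,
      (P t u : X → ℝ) =ᵐ[μ] fun x => ∫ y, p t x y * u y ∂μ)
    {t : ℝ} (ht : 0 < t) {B : Set X} (hB : MeasurableSet B) (hμB : μ B ≠ ⊤) :
    (P t (indicatorConstLp 2 hB hμB 1) : X → ℝ) =ᵐ[μ] fun x => ∫ y in B, p t x y ∂μ := by
  filter_upwards [hker t ht (indicatorConstLp 2 hB hμB 1)] with x hx
  rw [hx, ← integral_indicator hB]
  refine integral_congr_ae ?_
  filter_upwards [indicatorConstLp_coeFn (p := 2) (hs := hB) (hμs := hμB) (c := (1 : ℝ))] with y hy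
  rw [hy]
  by_cases h : y ∈ B <;> simp [h]

variable {X : Type*} [MetricSpace X] [MeasurableSpace X]

/-- A symmetric, conservative, continuous transition density with respect to `μ`. -/
structure IsTransitionDensity (μ : Measure X) (p : ℝ → X → X → ℝ) : Prop where
  continuous : ∀ t : ℝ, 0 < t → Continuous (fun z : X × X => p t z.1 z.2)
  nonneg : ∀ t : ℝ, 0 < t → ∀ x y : X, 0 ≤ p t x y
  symm : ∀ t : ℝ, 0 < t → ∀ x y : X, p t x y = p t y x
  lintegral_eq_one : ∀ t : ℝ, 0 < t → ∀ x : X, ∫⁻ y, ENNReal.ofReal (p t x y) ∂μ = 1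
  chapman : ∀ s t : ℝ, 0 < s → 0 < t → ∀ x : X, ∀ᵐ y ∂μ,
    ENNReal.ofReal (p (s + t) x y) =
      ∫⁻ z, ENNReal.ofReal (p s x z) * ENNReal.ofReal (p t z y) ∂μ

/-- This strong Feller property upgrades identities valid for almost every `x` to all `x`. -/
theorem WeakBakryEmery.continuous_integral {μ : Measure X} {p : ℝ → X → X → ℝ} {dW κ : ℝ}
    (h : WeakBakryEmery μ p dW κ) {t : ℝ} (ht : 0 < t) {g : X → ℝ} (hg : MemLp g ⊤ μ) :
    Continuous (fun x => ∫ z, p t x z * g z ∂μ) := by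
  obtain ⟨hκ, -, C, hC, h⟩ := h
  rw [continuous_iff_continuousAt]
  intro x
  rw [ContinuousAt, tendsto_iff_dist_tendsto_zero]
  refine squeeze_zero (fun _ => dist_nonneg) (fun y => (Real.dist_eq _ _).trans_le (h t ht g hg y x))
    ?_
  have h1 : Continuous (fun y => C * (dist y x ^ κ / t ^ (κ / dW)) * (eLpNorm g ⊤ μ).toReal) := by
    have : Continuous (fun y => dist y x ^ κ) :=
      (continuous_id.dist continuous_const).rpow_const fun _ => Or.inr hκ.le
    fun_prop
  have := h1.tendsto x
  simpa [Real.zero_rpow hκ.ne'] using this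

variable [BorelSpace X] {μ : Measure X} {p : ℝ → X → X → ℝ}

theorem integrable_of_lintegral_le
    (hcont : ∀ t : ℝ, 0 < t → Continuous (fun z : X × X => p t z.1 z.2)) {C : ℝ}
    (hC : ∀ t : ℝ, 0 < t → ∀ x : X, ∫⁻ y, ENNReal.ofReal (p t x y) ∂μ ≤ ENNReal.ofReal C)
    (hnn : ∀ t : ℝ, 0 < t → ∀ x y : X, 0 ≤ p t x y)
    {t : ℝ} (ht : 0 < t) (x : X) : Integrable (p t x) μ := by
  have hm : Measurable (p t x) :=
    ((hcont t ht).comp (Continuous.prodMk_right x)).measurable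
  refine ⟨hm.aestronglyMeasurable, ?_⟩
  rw [hasFiniteIntegral_iff_ofReal (ae_of_all _ (hnn t ht x))]
  exact (hC t ht x).trans_lt ENNReal.ofReal_lt_top

/-- The semigroup law applied to the indicator of `B` gives the identity for almost every `x`. Both
sides are heat integrals of bounded functions, hence continuous by `wBE(κ)`, and a measure of full
support leaves no exceptional point. -/
theorem setIntegral_chapman [μ.IsOpenPosMeasure] {E : DirichletForm μ}
    {P : ℝ → Lp ℝ 2 μ →L[ℝ] Lp ℝ 2 μ} (hP : E.IsHeatSemigroup P)
    (hker : ∀ t : ℝ, 0 < t → ∀ u : Lp ℝ 2 μ,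
      (P t u : X → ℝ) =ᵐ[μ] fun x => ∫ y, p t x y * u y ∂μ)
    {dW κ : ℝ} (hBE : WeakBakryEmery μ p dW κ)
    (hcont : ∀ t : ℝ, 0 < t → Continuous (fun z : X × X => p t z.1 z.2)) {C : ℝ} (hC0 : 0 < C)
    (hC : ∀ t : ℝ, 0 < t → ∀ x : X, ∫⁻ y, ENNReal.ofReal (p t x y) ∂μ ≤ ENNReal.ofReal C)
    (hnn : ∀ t : ℝ, 0 < t → ∀ x y : X, 0 ≤ p t x y)
    {s t : ℝ} (hs : 0 < s) (ht : 0 < t) {B : Set X} (hB : MeasurableSet B) (hμB : μ B ≠ ⊤) (x : X) :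
    ∫⁻ y in B, ENNReal.ofReal (p (s + t) x y) ∂μ =
      ∫⁻ z, ENNReal.ofReal (p s x z) * ∫⁻ y in B, ENNReal.ofReal (p t z y) ∂μ ∂μ := by
  have hint := fun {t : ℝ} (ht : 0 < t) (x : X) => integrable_of_lintegral_le hcont hC hnn ht x
  have hind : MemLp (B.indicator (fun _ => (1 : ℝ))) ⊤ μ :=
    memLp_indicator_const ⊤ hB 1 (Or.inr hμB)
  have hset : ∀ {t : ℝ}, 0 < t → ∀ x, ∫ z, p t x z * B.indicator (fun _ => (1 : ℝ)) z ∂μ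
      = ∫ y in B, p t x y ∂μ := by
    intro t ht x
    rw [← integral_indicator hB]
    congr 1; ext y
    by_cases h : y ∈ B <;> simp [h]
  have hc : ∀ {t : ℝ}, 0 < t → Continuous (fun x => ∫ y in B, p t x y ∂μ) := by
    intro t ht
    have := hBE.continuous_integral ht hind
    simpa only [hset ht] using this
  have hof : ∀ {t : ℝ}, 0 < t → ∀ x, ENNReal.ofReal (∫ y in B, p t x y ∂μ) =
      ∫⁻ y in B, ENNReal.ofReal (p t x y) ∂μ := fun ht x =>
    ofReal_integral_eq_lintegral_ofReal (hint ht x).integrableOn (ae_of_all _ (hnn _ ht x))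
  have hle : ∀ z, ∫ y in B, p t z y ∂μ ≤ C := by
    intro z
    have h1 := (hof ht z).trans_le ((setLIntegral_le_lintegral _ _).trans (hC t ht z))
    exact (ENNReal.ofReal_le_ofReal_iff hC0.le).1 h1
  have hge : ∀ z, 0 ≤ ∫ y in B, p t z y ∂μ := fun z =>
    integral_nonneg fun y => hnn t ht z y
  have hmem : MemLp (fun z => ∫ y in B, p t z y ∂μ) ⊤ μ := by
    refine memLp_top_of_bound (hc ht).measurable.aestronglyMeasurable C (ae_of_all _ fun z => ?_)
    rw [Real.norm_of_nonneg (hge z)]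
    exact hle z
  have hae : (fun x => ∫ y in B, p (s + t) x y ∂μ) =ᵐ[μ]
      fun x => ∫ z, p s x z * ∫ y in B, p t z y ∂μ ∂μ := by
    have h1 := heat_indicator hker (add_pos hs ht) hB hμB
    have h2 := hker s hs (P t (indicatorConstLp 2 hB hμB 1))
    rw [hP.add s t hs.le ht.le] at h1
    filter_upwards [h1, h2] with x h1 h2
    rw [← h1, ContinuousLinearMap.comp_apply, h2]
    refine integral_congr_ae ?_
    filter_upwards [heat_indicator hker ht hB hμB] with z hz
    rw [hz]
  have heq := congrFun (Measure.eq_of_ae_eq hae (hc (add_pos hs ht))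
    (hBE.continuous_integral hs hmem)) x
  rw [← hof (add_pos hs ht), heq, ofReal_integral_eq_lintegral_ofReal]
  · refine lintegral_congr fun z => ?_
    rw [ENNReal.ofReal_mul (hnn s hs x z), hof ht]
  · exact (hint hs x).mul_of_top_left hmem
  · exact ae_of_all _ fun z => mul_nonneg (hnn s hs x z) (hge z)

variable [SecondCountableTopology X]

theorem measurable_ofReal_kernel
    (hcont : ∀ t : ℝ, 0 < t → Continuous (fun z : X × X => p t z.1 z.2)) {t : ℝ} (ht : 0 < t) :
    Measurable (fun z : X × X => ENNReal.ofReal (p t z.1 z.2)) :=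
  (hcont t ht).measurable.ennreal_ofReal

variable [SigmaFinite μ]

theorem ae_chapman
    (hcont : ∀ t : ℝ, 0 < t → Continuous (fun z : X × X => p t z.1 z.2))
    (h : ∀ s t : ℝ, 0 < s → 0 < t → ∀ B : Set X, MeasurableSet B → μ B ≠ ⊤ → ∀ x : X,
      ∫⁻ y in B, ENNReal.ofReal (p (s + t) x y) ∂μ =
      ∫⁻ z, ENNReal.ofReal (p s x z) * ∫⁻ y in B, ENNReal.ofReal (p t z y) ∂μ ∂μ)
    {s t : ℝ} (hs : 0 < s) (ht : 0 < t) (x : X) :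
    ∀ᵐ y ∂μ, ENNReal.ofReal (p (s + t) x y) =
      ∫⁻ z, ENNReal.ofReal (p s x z) * ENNReal.ofReal (p t z y) ∂μ := by
  have hm1 : Measurable (fun z => ENNReal.ofReal (p s x z)) :=
    (measurable_ofReal_kernel hcont hs).comp measurable_prodMk_left
  have hm2 : Measurable (fun q : X × X => ENNReal.ofReal (p s x q.2) * ENNReal.ofReal (p t q.2 q.1)) :=
    (hm1.comp measurable_snd).mul ((measurable_ofReal_kernel hcont ht).comp measurable_swap)
  refine ae_eq_of_forall_setLIntegral_eq_of_sigmaFinite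
    ((measurable_ofReal_kernel hcont (add_pos hs ht)).comp measurable_prodMk_left)
    hm2.lintegral_prod_right' fun B hB hμB => ?_
  rw [h s t hs ht B hB hμB.ne x, lintegral_lintegral_swap hm2.aemeasurable]
  refine lintegral_congr fun z => ?_
  rw [lintegral_const_mul]
  exact (measurable_ofReal_kernel hcont ht).comp measurable_prodMk_left

/-- Self-adjointness of `P_t`, tested on indicators, says that `p_t` has equal integrals over `A ×
B` and `B × A`. A strict inequality at a point would persist on a product of small balls, by
continuity, and contradict this. -/
theorem heat_kernel_symm [IsFiniteMeasureOnCompacts μ] [ProperSpace X] [μ.IsOpenPosMeasure]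
    {E : DirichletForm μ}
    {P : ℝ → Lp ℝ 2 μ →L[ℝ] Lp ℝ 2 μ} (hP : E.IsHeatSemigroup P)
    (hker : ∀ t : ℝ, 0 < t → ∀ u : Lp ℝ 2 μ,
      (P t u : X → ℝ) =ᵐ[μ] fun x => ∫ y, p t x y * u y ∂μ)
    (hcont : ∀ t : ℝ, 0 < t → Continuous (fun z : X × X => p t z.1 z.2)) {C : ℝ} (hC0 : 0 < C)
    (hC : ∀ t : ℝ, 0 < t → ∀ x : X, ∫⁻ y, ENNReal.ofReal (p t x y) ∂μ ≤ ENNReal.ofReal C)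
    (hnn : ∀ t : ℝ, 0 < t → ∀ x y : X, 0 ≤ p t x y) {t : ℝ} (ht : 0 < t) (x y : X) :
    p t x y = p t y x := by
  have hof : ∀ (B : Set X) (x : X), ENNReal.ofReal (∫ y in B, p t x y ∂μ) =
      ∫⁻ y in B, ENNReal.ofReal (p t x y) ∂μ := fun B x =>
    ofReal_integral_eq_lintegral_ofReal
      (integrable_of_lintegral_le hcont hC hnn ht x).integrableOn (ae_of_all _ (hnn t ht x))
  have hofm : ∀ (A B : Set X), MeasurableSet A → μ A ≠ ⊤ →
      ENNReal.ofReal (∫ x in A, ∫ y in B, p t x y ∂μ ∂μ) =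
      ∫⁻ x in A, ∫⁻ y in B, ENNReal.ofReal (p t x y) ∂μ ∂μ := by
    intro A B hA hμA
    have hge : ∀ z, 0 ≤ ∫ y in B, p t z y ∂μ := fun z =>
      integral_nonneg fun y => hnn t ht z y
    rw [ofReal_integral_eq_lintegral_ofReal _ (ae_of_all _ hge)]
    · exact lintegral_congr fun x => hof B x
    · have : IsFiniteMeasure (μ.restrict A) := ⟨by simpa using hμA.lt_top⟩
      refine Integrable.of_bound (C := C) ?_ (ae_of_all _ fun z => ?_)
      · exact ((hcont t ht).stronglyMeasurable.integral_prod_right').aestronglyMeasurable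
      · rw [Real.norm_of_nonneg (hge z)]
        have h1 := (hof B z).trans_le ((setLIntegral_le_lintegral _ _).trans (hC t ht z))
        exact (ENNReal.ofReal_le_ofReal_iff hC0.le).1 h1
  have key : ∀ (A B : Set X), MeasurableSet A → μ A ≠ ⊤ → MeasurableSet B → μ B ≠ ⊤ →
      ∫⁻ x in A, ∫⁻ y in B, ENNReal.ofReal (p t x y) ∂μ ∂μ =
      ∫⁻ x in B, ∫⁻ y in A, ENNReal.ofReal (p t x y) ∂μ ∂μ := by
    intro A B hA hμA hB hμB
    rw [← hofm A B hA hμA, ← hofm B A hB hμB]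
    congr 1
    have h1 := hP.symm t ht.le (indicatorConstLp 2 hB hμB 1) (indicatorConstLp 2 hA hμA 1)
    rw [real_inner_comm, L2.inner_indicatorConstLp_one, L2.inner_indicatorConstLp_one] at h1
    rw [← integral_congr_ae (ae_restrict_of_ae (heat_indicator hker ht hB hμB)),
      ← integral_congr_ae (ae_restrict_of_ae (heat_indicator hker ht hA hμA)), h1]
  have hle : ∀ x y : X, p t y x ≤ p t x y := by
    intro x y
    by_contra! hlt
    obtain ⟨m, hm1, hm2⟩ := exists_between hlt
    obtain ⟨m', hm3, hm4⟩ := exists_between hm2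
    have hm0 : 0 ≤ m := (hnn t ht x y).trans hm1.le
    have e1 : ∀ᶠ z : X × X in 𝓝 (x, y), p t z.1 z.2 < m :=
      (hcont t ht).continuousAt.eventually_lt_const hm1
    have e2 : ∀ᶠ z : X × X in 𝓝 (x, y), m' < p t z.2 z.1 :=
      ((hcont t ht).comp continuous_swap).continuousAt.eventually_const_lt hm4
    obtain ⟨δ, hδ, hball⟩ := Metric.eventually_nhds_iff_ball.1 (e1.and e2)
    rw [← ball_prod_same] at hball
    have hfin : ∀ z : X, μ (Metric.ball z δ) ≠ ⊤ := fun z => measure_ball_lt_top.ne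
    have hpos : ∀ z : X, μ (Metric.ball z δ) ≠ 0 := fun z => (Metric.measure_ball_pos μ z hδ).ne'
    have hk := key (Metric.ball x δ) (Metric.ball y δ) measurableSet_ball (hfin x)
      measurableSet_ball (hfin y)
    have b1 : ∫⁻ a in Metric.ball x δ, ∫⁻ b in Metric.ball y δ, ENNReal.ofReal (p t a b) ∂μ ∂μ
        ≤ ENNReal.ofReal m * μ (Metric.ball y δ) * μ (Metric.ball x δ) := by
      rw [← setLIntegral_const, ← setLIntegral_const]
      exact setLIntegral_mono' measurableSet_ball fun a ha =>
        setLIntegral_mono' measurableSet_ball fun b hb =>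
          ENNReal.ofReal_le_ofReal (hball (a, b) ⟨ha, hb⟩).1.le
    have b2 : ENNReal.ofReal m' * μ (Metric.ball x δ) * μ (Metric.ball y δ) ≤
        ∫⁻ b in Metric.ball y δ, ∫⁻ a in Metric.ball x δ, ENNReal.ofReal (p t b a) ∂μ ∂μ := by
      rw [← setLIntegral_const, ← setLIntegral_const]
      exact setLIntegral_mono' measurableSet_ball fun b hb =>
        setLIntegral_mono' measurableSet_ball fun a ha =>
          ENNReal.ofReal_le_ofReal (hball (a, b) ⟨ha, hb⟩).2.le
    have b3 := (b2.trans_eq hk.symm).trans b1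
    rw [mul_right_comm, ENNReal.mul_le_mul_iff_left (hpos x) (hfin x),
      ENNReal.mul_le_mul_iff_left (hpos y) (hfin y), ENNReal.ofReal_le_ofReal_iff hm0] at b3
    linarith
  exact le_antisymm (hle y x) (hle x y)

/-- Conservativeness of a semigroup whose total masses are bounded above and below and become
constant in space as time tends to infinity. -/
theorem integral_eq_one_of_weakBakryEmery {dW κ : ℝ} (hBE : WeakBakryEmery μ p dW κ)
    (hcont : ∀ t : ℝ, 0 < t → Continuous (fun z : X × X => p t z.1 z.2)) {C c : ℝ} (hC0 : 0 < C)
    (hc0 : 0 < c) (hdW : 0 < dW)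
    (hC : ∀ t : ℝ, 0 < t → ∀ x : X, ∫⁻ y, ENNReal.ofReal (p t x y) ∂μ ≤ ENNReal.ofReal C)
    (hc : ∀ t : ℝ, 0 < t → ∀ x : X, ENNReal.ofReal c ≤ ∫⁻ y, ENNReal.ofReal (p t x y) ∂μ)
    (hnn : ∀ t : ℝ, 0 < t → ∀ x y : X, 0 ≤ p t x y)
    (hck : ∀ s t : ℝ, 0 < s → 0 < t → ∀ x : X, ∀ᵐ y ∂μ, ENNReal.ofReal (p (s + t) x y) =
      ∫⁻ z, ENNReal.ofReal (p s x z) * ENNReal.ofReal (p t z y) ∂μ)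
    {t : ℝ} (ht : 0 < t) (x : X) : ∫⁻ y, ENNReal.ofReal (p t x y) ∂μ = 1 := by
  have hint := fun {t : ℝ} (ht : 0 < t) (x : X) => integrable_of_lintegral_le hcont hC hnn ht x
  set h : ℝ → X → ℝ := fun t x => ∫ y, p t x y ∂μ
  have hof : ∀ {t : ℝ}, 0 < t → ∀ x, ENNReal.ofReal (h t x) =
      ∫⁻ y, ENNReal.ofReal (p t x y) ∂μ := fun ht x =>
    ofReal_integral_eq_lintegral_ofReal (hint ht x) (ae_of_all _ (hnn _ ht x))
  have hge0 : ∀ {t : ℝ}, 0 < t → ∀ x, 0 ≤ h t x := fun ht x => integral_nonneg (hnn _ ht x)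
  have hle : ∀ {t : ℝ}, 0 < t → ∀ x, h t x ≤ C := fun ht x =>
    (ENNReal.ofReal_le_ofReal_iff hC0.le).1 ((hof ht x).trans_le (hC _ ht x))
  have hge : ∀ {t : ℝ}, 0 < t → ∀ x, c ≤ h t x := fun ht x =>
    (ENNReal.ofReal_le_ofReal_iff (hge0 ht x)).1 ((hc _ ht x).trans_eq (hof ht x).symm)
  obtain ⟨hκ, -, D, hD, hBE'⟩ := id hBE
  set N := (eLpNorm (fun _ : X => (1 : ℝ)) ⊤ μ).toReal
  have hone : MemLp (fun _ : X => (1 : ℝ)) ⊤ μ := memLp_top_const 1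
  have hosc : ∀ {t : ℝ}, 0 < t → ∀ x y, |h t x - h t y| ≤ D * (dist x y ^ κ / t ^ (κ / dW)) * N := by
    intro t ht x y
    have := hBE' t ht _ hone x y
    simpa only [mul_one] using this
  have hcth : ∀ {t : ℝ}, 0 < t → Continuous (h t) := by
    intro t ht
    have := hBE.continuous_integral ht hone
    simpa only [mul_one] using this
  have hsemi : ∀ {s t : ℝ}, 0 < s → 0 < t → ∀ x, h (s + t) x = ∫ z, p s x z * h t z ∂μ := by
    intro s t hs ht x
    have hm1 : Measurable (fun z => ENNReal.ofReal (p s x z)) :=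
      (measurable_ofReal_kernel hcont hs).comp measurable_prodMk_left
    have hm2 : Measurable
        (fun q : X × X => ENNReal.ofReal (p s x q.2) * ENNReal.ofReal (p t q.2 q.1)) :=
      (hm1.comp measurable_snd).mul ((measurable_ofReal_kernel hcont ht).comp measurable_swap)
    have hnn' : ∀ z, 0 ≤ p s x z * h t z := fun z => mul_nonneg (hnn s hs x z) (hge0 ht z)
    have e : ENNReal.ofReal (h (s + t) x) = ENNReal.ofReal (∫ z, p s x z * h t z ∂μ) := by
      rw [hof (add_pos hs ht), lintegral_congr_ae (hck s t hs ht x),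
        lintegral_lintegral_swap hm2.aemeasurable, ofReal_integral_eq_lintegral_ofReal _
        (ae_of_all _ hnn')]
      · refine lintegral_congr fun z => ?_
        rw [lintegral_const_mul, ENNReal.ofReal_mul (hnn s hs x z), hof ht]
        exact (measurable_ofReal_kernel hcont ht).comp measurable_prodMk_left
      · refine (hint hs x).mul_bdd (c := C) (hcth ht).measurable.aestronglyMeasurable
          (ae_of_all _ fun z => ?_)
        rw [Real.norm_of_nonneg (hge0 ht z)]
        exact hle ht z
    exact (ENNReal.ofReal_eq_ofReal_iff (hge0 (add_pos hs ht) x) (integral_nonneg hnn')).1 e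
  -- Large times are sampled at `n + 1`, so that they are always positive. By `wBE(κ)` the
  -- oscillation of `h t = P_t 1` between two fixed points decays like `t^(-κ/dW)`.
  have hpow : Tendsto (fun n : ℕ => (((n : ℝ) + 1) ^ (κ / dW))⁻¹) atTop (𝓝 0) :=
    ((tendsto_rpow_atTop (div_pos hκ hdW)).comp
      (tendsto_atTop_add_const_right _ 1 tendsto_natCast_atTop_atTop)).inv_tendsto_atTop
  have hflat : ∀ x y, Tendsto (fun n : ℕ => h (n + 1) x - h (n + 1) y) atTop (𝓝 0) := by
    intro x y
    refine squeeze_zero_norm (fun n => hosc (by positivity) x y) ?_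
    have := (hpow.const_mul (D * dist x y ^ κ * N))
    rw [mul_zero] at this
    refine this.congr fun n => ?_
    rw [div_eq_mul_inv]; ring
  -- Since `h (s + t) = P_s (h t)` and `h t` flattens as `t → ∞`, dominated convergence gives `h (s
  -- + t) x ≈ h t x0 * h s x`.
  have happ : ∀ {s : ℝ}, 0 < s → ∀ x x0, Tendsto
      (fun n : ℕ => h (s + (n + 1)) x - h (n + 1) x0 * h s x) atTop (𝓝 0) := by
    intro s hs x x0
    have h1 : ∀ n : ℕ, h (s + (n + 1)) x - h (n + 1) x0 * h s x =
        ∫ z, p s x z * (h (n + 1) z - h (n + 1) x0) ∂μ := by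
      intro n
      have hn : (0 : ℝ) < n + 1 := by positivity
      have i1 : Integrable (fun z => p s x z * h (n + 1) z) μ := by
        refine (hint hs x).mul_bdd (c := C) (hcth hn).measurable.aestronglyMeasurable
          (ae_of_all _ fun z => ?_)
        rw [Real.norm_of_nonneg (hge0 hn z)]
        exact hle hn z
      rw [hsemi hs hn]
      simp_rw [mul_sub]
      rw [integral_sub i1 ((hint hs x).mul_const _), integral_mul_const, mul_comm (h _ x0)]
    simp_rw [h1]
    have hlim := tendsto_integral_of_dominated_convergence
      (F := fun (n : ℕ) z => p s x z * (h (n + 1) z - h (n + 1) x0)) (f := fun _ => 0) (μ := μ)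
      (fun z => p s x z * C) ?_ ((hint hs x).mul_const _) ?_ ?_
    · simpa using hlim
    · intro n
      have hn : (0 : ℝ) < n + 1 := by positivity
      exact (hint hs x).aestronglyMeasurable.mul
        ((hcth hn).sub continuous_const).measurable.aestronglyMeasurable
    · intro n
      have hn : (0 : ℝ) < n + 1 := by positivity
      refine ae_of_all _ fun z => ?_
      rw [norm_mul, Real.norm_of_nonneg (hnn s hs x z), Real.norm_eq_abs]
      refine mul_le_mul_of_nonneg_left ?_ (hnn s hs x z)
      rw [abs_le]
      constructor <;> linarith [hge0 hn z, hge0 hn x0, hle hn z, hle hn x0]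
    · refine ae_of_all _ fun z => ?_
      simpa using (hflat z x0).const_mul (p s x z)
  -- The left side of this approximation flattens as well, so `h t x0 * (h s x - h s y) → 0`; the
  -- lower bound `h t ≥ c` forces the second factor to vanish.
  have hconst : ∀ {s : ℝ}, 0 < s → ∀ x y, h s x = h s y := by
    intro s hs x y
    have h2 : Tendsto (fun n : ℕ => h (s + (n + 1)) x - h (s + (n + 1)) y) atTop (𝓝 0) := by
      refine squeeze_zero_norm (fun n => hosc (by positivity) x y) ?_
      have := (hpow.const_mul (D * dist x y ^ κ * N))
      rw [mul_zero] at this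
      refine squeeze_zero (fun n => by positivity) (fun n => ?_) this
      have : (((n : ℝ) + 1) ^ (κ / dW)) ≤ ((s + (n + 1)) ^ (κ / dW)) := by
        exact Real.rpow_le_rpow (by positivity) (by linarith) (div_pos hκ hdW).le
      calc _ ≤ D * (dist x y ^ κ / ((n : ℝ) + 1) ^ (κ / dW)) * N := by gcongr
        _ = _ := by rw [div_eq_mul_inv]; ring
    have h3 : Tendsto (fun n : ℕ => h (n + 1) x * (h s x - h s y)) atTop (𝓝 0) := by
      have := (h2.sub (happ hs x x)).add (happ hs y x)
      simp only [sub_zero, add_zero] at this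
      refine this.congr fun n => ?_
      ring
    have h4 : Tendsto (fun _ : ℕ => c * |h s x - h s y|) atTop (𝓝 0) := by
      refine squeeze_zero (fun n => by positivity) (fun n => ?_) (by simpa using h3.abs)
      gcongr
      exact (hge (by positivity) x).trans (le_abs_self _)
    have h5 := tendsto_nhds_unique h4 tendsto_const_nhds
    have h6 : |h s x - h s y| = 0 := by
      rcases mul_eq_zero.1 h5.symm with h | h
      · exact absurd h hc0.ne'
      · exact h
    exact sub_eq_zero.1 (abs_eq_zero.1 h6)
  -- For spatially constant masses the semigroup law is multiplicative. Powers that stay between `c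
  -- > 0` and `C` have base `1`.
  have hiter : ∀ n : ℕ, h ((n + 1) * t) x = h t x ^ (n + 1) := by
    intro n
    induction n with
    | zero => simp
    | succ n ih =>
      have hn : (0 : ℝ) < (n + 1) * t := by positivity
      have e : ((n + 1 : ℕ) + 1 : ℝ) * t = t + (n + 1) * t := by push_cast; ring
      rw [e, hsemi ht hn]
      have : ∀ z, p t x z * h ((n + 1) * t) z = p t x z * h t x ^ (n + 1) := fun z => by
        rw [hconst hn z x, ih]
      simp_rw [this]
      rw [integral_mul_const, pow_succ' _ (n + 1)]
  have h1 : h t x = 1 := by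
    rcases lt_trichotomy (h t x) 1 with hlt | heq | hgt
    · have := (tendsto_pow_atTop_nhds_zero_of_lt_one (hge0 ht x) hlt).eventually_lt_const hc0
      obtain ⟨n, hn, hn1⟩ := (this.and (eventually_ge_atTop 1)).exists
      obtain ⟨m, rfl⟩ := Nat.exists_eq_add_of_le' hn1
      have := hge (t := (m + 1) * t) (by positivity) x
      rw [hiter] at this
      linarith
    · exact heq
    · obtain ⟨n, hn, hn1⟩ := (((tendsto_pow_atTop_atTop_of_one_lt hgt).eventually_gt_atTop C).and
        (eventually_ge_atTop 1)).exists
      obtain ⟨m, rfl⟩ := Nat.exists_eq_add_of_le' hn1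
      have := hle (t := (m + 1) * t) (by positivity) x
      rw [hiter] at this
      linarith
  rw [← hof ht, h1, ENNReal.ofReal_one]

/-- The heat kernel is a symmetric, conservative transition density. -/
theorem isTransitionDensity [IsFiniteMeasureOnCompacts μ] [ProperSpace X] [μ.IsOpenPosMeasure]
    {E : DirichletForm μ}
    {P : ℝ → Lp ℝ 2 μ →L[ℝ] Lp ℝ 2 μ} (hP : E.IsHeatSemigroup P)
    (hker : ∀ t : ℝ, 0 < t → ∀ u : Lp ℝ 2 μ,
      (P t u : X → ℝ) =ᵐ[μ] fun x => ∫ y, p t x y * u y ∂μ)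
    (hcont : ∀ t : ℝ, 0 < t → Continuous (fun z : X × X => p t z.1 z.2))
    {dH dW κ c₃ c₄ c₅ c₆ : ℝ} (hdH : 0 < dH) (hdW : 2 ≤ dW) (hμ : IsAhlforsRegular μ dH)
    (hb : PointwiseBounds p dH dW c₃ c₄ c₅ c₆) (hBE : WeakBakryEmery μ p dW κ) :
    IsTransitionDensity μ p := by
  have hnn : ∀ t : ℝ, 0 < t → ∀ x y : X, 0 ≤ p t x y := fun t ht => hb.nonneg ht
  obtain ⟨C, hC0, hC⟩ := hb.lintegral_le hdW hdH hμ
  obtain ⟨c, hc0, hc⟩ := hb.le_lintegral hdW hμ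
  have hck := fun s t hs ht x => ae_chapman hcont (s := s) (t := t)
    (fun s t hs ht B hB hμB x => setIntegral_chapman hP hker hBE hcont hC0 hC hnn hs ht hB hμB x)
    hs ht x
  exact ⟨hcont, hnn, fun t ht => heat_kernel_symm hP hker hcont hC0 hC hnn ht,
    fun t ht => integral_eq_one_of_weakBakryEmery hBE hcont hC0 hc0 (by linarith) hC hc hnn hck ht,
    hck⟩

end Kernel

/-! ### Subadditivity in time of the heat oscillation -/

section Oscillation

variable {X : Type*} [MetricSpace X] [MeasurableSpace X]

/-- The mean oscillation `∫ p_t(x, z) |f(z) - f(x)| dμ(z)` with respect to the heat kernel. -/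
noncomputable def heatOscillation (μ : Measure X) (p : ℝ → X → X → ℝ) (f : X → ℝ) (t : ℝ) (x : X) : ℝ≥0∞ :=
  ∫⁻ z, ENNReal.ofReal (p t x z) * ‖f z - f x‖ₑ ∂μ

variable {μ : Measure X} {p : ℝ → X → X → ℝ} {f : X → ℝ}

namespace IsTransitionDensity

theorem lintegral_left_eq_one (h : IsTransitionDensity μ p) {t : ℝ} (ht : 0 < t) (z : X) :
    ∫⁻ x, ENNReal.ofReal (p t x z) ∂μ = 1 := by
  rw [← h.lintegral_eq_one t ht z]
  exact lintegral_congr fun x => by rw [h.symm t ht]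

variable [BorelSpace X] [SecondCountableTopology X]

theorem measurable_kernel (h : IsTransitionDensity μ p) {t : ℝ} (ht : 0 < t) :
    Measurable (fun z : X × X => ENNReal.ofReal (p t z.1 z.2)) :=
  measurable_ofReal_kernel h.continuous ht

theorem measurable_kernel_right (h : IsTransitionDensity μ p) {t : ℝ} (ht : 0 < t) (x : X) :
    Measurable (fun z => ENNReal.ofReal (p t x z)) :=
  (h.measurable_kernel ht).comp measurable_prodMk_left

theorem measurable_kernel_left (h : IsTransitionDensity μ p) {t : ℝ} (ht : 0 < t) (x : X) :
    Measurable (fun z => ENNReal.ofReal (p t z x)) :=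
  (h.measurable_kernel ht).comp measurable_prodMk_right

/-- Insert `φ x ≤ φ z + L d(x, z)`: the first term keeps total mass one, and the first moment of
`p_s` is at most `D s^(1/dW)` times the total mass of `p_{Ms}`. This measures how far the heat flow
smears a cut-off. -/
theorem lintegral_lipschitz_le (h : IsTransitionDensity μ p) {dW D : ℝ} {M : ℕ} (hM : 1 ≤ M)
    (hD : 0 < D) (hmom : ∀ t : ℝ, 0 < t → ∀ x y : X,
      p t x y * dist x y ^ (1 : ℝ) ≤ D * t ^ (1 / dW) * p (M * t) x y)
    {φ : X → ℝ≥0} {L : ℝ≥0} (hφ : LipschitzWith L φ) {s : ℝ} (hs : 0 < s) (z : X) :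
    ∫⁻ x, ENNReal.ofReal (p s x z) * φ x ∂μ ≤ φ z + L * ENNReal.ofReal (D * s ^ (1 / dW)) := by
  have hM0 : (0 : ℝ) < M := by exact_mod_cast hM
  have hk := h.measurable_kernel_left hs z
  have hkM := h.measurable_kernel_left (mul_pos hM0 hs) z
  calc ∫⁻ x, ENNReal.ofReal (p s x z) * φ x ∂μ
      ≤ ∫⁻ x, (ENNReal.ofReal (p s x z) * φ z +
          L * ENNReal.ofReal (D * s ^ (1 / dW)) * ENNReal.ofReal (p (M * s) x z)) ∂μ := by
        refine lintegral_mono fun x => ?_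
        have h1 : (φ x : ℝ≥0∞) ≤ φ z + L * ENNReal.ofReal (dist x z) := by
          have h2 : dist (φ x) (φ z) ≤ L * dist x z := hφ.dist_le_mul x z
          rw [NNReal.dist_eq] at h2
          have h3 : (φ x : ℝ) ≤ φ z + L * dist x z := by linarith [le_abs_self ((φ x : ℝ) - φ z)]
          have h4 := ENNReal.ofReal_le_ofReal h3
          rwa [ENNReal.ofReal_add (by positivity) (by positivity), ENNReal.ofReal_mul (by positivity),
            ENNReal.ofReal_coe_nnreal, ENNReal.ofReal_coe_nnreal, ENNReal.ofReal_coe_nnreal] at h4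
        refine (mul_le_mul_right h1 _).trans ?_
        rw [mul_add, mul_left_comm, ← ENNReal.ofReal_mul (h.nonneg s hs x z), mul_assoc,
          ← ENNReal.ofReal_mul (by positivity)]
        have h5 := hmom s hs x z
        rw [Real.rpow_one] at h5
        gcongr
    _ = _ := by
        rw [lintegral_add_left (hk.mul_const _), lintegral_mul_const _ hk,
          lintegral_const_mul _ hkM, h.lintegral_left_eq_one hs,
          h.lintegral_left_eq_one (mul_pos hM0 hs), one_mul, mul_one]

variable [SigmaFinite μ]

theorem measurable_heatOscillation (h : IsTransitionDensity μ p) (hf : Measurable f) {t : ℝ}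
    (ht : 0 < t) : Measurable (heatOscillation μ p f t) := by
  have : Measurable (fun q : X × X => ENNReal.ofReal (p t q.1 q.2) * ‖f q.2 - f q.1‖ₑ) :=
    (h.measurable_kernel ht).mul
      ((hf.comp measurable_snd).sub (hf.comp measurable_fst)).enorm
  exact this.lintegral_prod_right'

/-- Split the step from `x` to `y` at an intermediate point `z` by Chapman-Kolmogorov and use the
triangle inequality at `z`; conservativeness integrates out the unused kernel. -/
theorem heatOscillation_add_le (h : IsTransitionDensity μ p) (hf : Measurable f) {s t : ℝ}
    (hs : 0 < s) (ht : 0 < t) (x : X) :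
    heatOscillation μ p f (s + t) x ≤ heatOscillation μ p f s x +
      ∫⁻ z, ENNReal.ofReal (p s x z) * heatOscillation μ p f t z ∂μ := by
  have hks := h.measurable_kernel_right hs x
  have m1 : Measurable (fun q : X × X => ENNReal.ofReal (p s x q.2) * ENNReal.ofReal (p t q.2 q.1)) :=
    (hks.comp measurable_snd).fun_mul ((h.measurable_kernel ht).comp measurable_swap)
  have m2 : Measurable (fun q : X × X =>
      ENNReal.ofReal (p s x q.2) * ENNReal.ofReal (p t q.2 q.1) * ‖f q.1 - f x‖ₑ) :=
    m1.fun_mul ((hf.comp measurable_fst).sub_const _).enorm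
  calc heatOscillation μ p f (s + t) x
      = ∫⁻ y, ∫⁻ z, ENNReal.ofReal (p s x z) * ENNReal.ofReal (p t z y) * ‖f y - f x‖ₑ ∂μ ∂μ := by
        refine lintegral_congr_ae ?_
        filter_upwards [h.chapman s t hs ht x] with y hy
        rw [hy, lintegral_mul_const]
        exact m1.comp measurable_prodMk_left
    _ = ∫⁻ z, ∫⁻ y, ENNReal.ofReal (p s x z) * ENNReal.ofReal (p t z y) * ‖f y - f x‖ₑ ∂μ ∂μ :=
        lintegral_lintegral_swap m2.aemeasurable
    _ ≤ ∫⁻ z, (ENNReal.ofReal (p s x z) * ‖f z - f x‖ₑ +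
          ENNReal.ofReal (p s x z) * heatOscillation μ p f t z) ∂μ := by
        refine lintegral_mono fun z => ?_
        have hkt := h.measurable_kernel_right ht z
        calc ∫⁻ y, ENNReal.ofReal (p s x z) * ENNReal.ofReal (p t z y) * ‖f y - f x‖ₑ ∂μ
            ≤ ∫⁻ y, (ENNReal.ofReal (p s x z) * ‖f z - f x‖ₑ * ENNReal.ofReal (p t z y) +
                ENNReal.ofReal (p s x z) * (ENNReal.ofReal (p t z y) * ‖f y - f z‖ₑ)) ∂μ := by
              refine lintegral_mono fun y => ?_
              have : ‖f y - f x‖ₑ ≤ ‖f y - f z‖ₑ + ‖f z - f x‖ₑ := by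
                simpa using enorm_add_le (f y - f z) (f z - f x)
              refine (mul_le_mul_right this _).trans_eq ?_
              ring
          _ = _ := by
              rw [lintegral_add_left (hkt.const_mul _), lintegral_const_mul _ hkt,
                h.lintegral_eq_one t ht, mul_one, lintegral_const_mul]
              · rfl
              · exact hkt.fun_mul (hf.sub_const _).enorm
    _ = _ := by
        rw [lintegral_add_left (hks.fun_mul (hf.sub_const _).enorm)]
        rfl

/-- After Tonelli the weight in front of the oscillation at time `t` is the heat flow of `φ` at time
`s`, which exceeds `φ` by at most `δ`. For `φ = 1`, `δ = 0` this is plain subadditivity. -/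
theorem lintegral_heatOscillation_add_le (h : IsTransitionDensity μ p) (hf : Measurable f)
    {φ : X → ℝ≥0∞} (hφ : Measurable φ) {δ : ℝ≥0∞} {s t : ℝ} (hs : 0 < s) (ht : 0 < t)
    (hδ : ∀ z, ∫⁻ x, ENNReal.ofReal (p s x z) * φ x ∂μ ≤ φ z + δ) :
    ∫⁻ x, φ x * heatOscillation μ p f (s + t) x ∂μ ≤
      ∫⁻ x, φ x * heatOscillation μ p f s x ∂μ + (∫⁻ x, φ x * heatOscillation μ p f t x ∂μ +
        δ * ∫⁻ x, heatOscillation μ p f t x ∂μ) := by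
  have hms := h.measurable_heatOscillation hf hs
  have hmt := h.measurable_heatOscillation hf ht
  have m1 : Measurable (fun q : X × X =>
      φ q.1 * (ENNReal.ofReal (p s q.1 q.2) * heatOscillation μ p f t q.2)) :=
    (hφ.comp measurable_fst).fun_mul ((h.measurable_kernel hs).fun_mul (hmt.comp measurable_snd))
  calc ∫⁻ x, φ x * heatOscillation μ p f (s + t) x ∂μ
      ≤ ∫⁻ x, (φ x * heatOscillation μ p f s x +
          ∫⁻ z, φ x * (ENNReal.ofReal (p s x z) * heatOscillation μ p f t z) ∂μ) ∂μ := by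
        refine lintegral_mono fun x => ?_
        rw [lintegral_const_mul _ ((h.measurable_kernel_right hs x).fun_mul hmt), ← mul_add]
        exact mul_le_mul_right (h.heatOscillation_add_le hf hs ht x) _
    _ = ∫⁻ x, φ x * heatOscillation μ p f s x ∂μ +
          ∫⁻ z, ∫⁻ x, φ x * (ENNReal.ofReal (p s x z) * heatOscillation μ p f t z) ∂μ ∂μ := by
        rw [lintegral_add_left (hφ.fun_mul hms), lintegral_lintegral_swap m1.aemeasurable]
    _ ≤ ∫⁻ x, φ x * heatOscillation μ p f s x ∂μ +
          ∫⁻ z, (φ z * heatOscillation μ p f t z + δ * heatOscillation μ p f t z) ∂μ := by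
        refine add_le_add le_rfl (lintegral_mono fun z => ?_)
        rw [← add_mul]
        refine le_trans (le_of_eq ?_) (mul_le_mul_left (hδ z) _)
        rw [← lintegral_mul_const _ ((h.measurable_kernel_left hs z).fun_mul hφ)]
        refine lintegral_congr fun x => ?_
        ring
    _ = _ := by rw [lintegral_add_left (hφ.fun_mul hmt), lintegral_const_mul _ hmt]

/-- Iterated subadditivity, at the price of one error `δ` per step. The horizon `T` bounds the times
at which the weight may spread, so that `δ` can be chosen small with `T`. -/
theorem lintegral_heatOscillation_nat_mul_le (h : IsTransitionDensity μ p) (hf : Measurable f)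
    {φ : X → ℝ≥0∞} (hφ : Measurable φ) {δ : ℝ≥0∞} {t T : ℝ} (ht : 0 < t)
    (hδ : ∀ s, 0 < s → s ≤ T → ∀ z, ∫⁻ x, ENNReal.ofReal (p s x z) * φ x ∂μ ≤ φ z + δ)
    {n : ℕ} (hn : 1 ≤ n) (hT : n * t ≤ T) :
    ∫⁻ x, φ x * heatOscillation μ p f (n * t) x ∂μ ≤
      n * (∫⁻ x, φ x * heatOscillation μ p f t x ∂μ +
        δ * ∫⁻ x, heatOscillation μ p f t x ∂μ) := by
  induction n, hn using Nat.le_induction with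
  | base => simp
  | succ n hn ih =>
    have hn0 : (0 : ℝ) < n := by exact_mod_cast hn
    have hnT : n * t ≤ T := by
      refine le_trans ?_ hT
      push_cast
      nlinarith
    have e : ((n + 1 : ℕ) : ℝ) * t = n * t + t := by push_cast; ring
    rw [e]
    refine (h.lintegral_heatOscillation_add_le hf hφ (by positivity) ht
      (hδ _ (by positivity) hnT)).trans ?_
    refine (add_le_add_left (ih hnT) _).trans_eq ?_
    push_cast
    ring

/-- The oscillation integrates to at most `2 ‖f‖₁`. Only finiteness matters: a term can be absorbed
only if it is finite. -/
theorem lintegral_heatOscillation_lt_top (h : IsTransitionDensity μ p) (hf : Measurable f)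
    (hf1 : ∫⁻ x, ‖f x‖ₑ ∂μ < ⊤) {t : ℝ} (ht : 0 < t) :
    ∫⁻ x, heatOscillation μ p f t x ∂μ < ⊤ := by
  have m1 : Measurable (fun q : X × X => ENNReal.ofReal (p t q.1 q.2) * ‖f q.2‖ₑ) :=
    (h.measurable_kernel ht).fun_mul (hf.comp measurable_snd).enorm
  calc ∫⁻ x, heatOscillation μ p f t x ∂μ
      ≤ ∫⁻ x, (‖f x‖ₑ + ∫⁻ z, ENNReal.ofReal (p t x z) * ‖f z‖ₑ ∂μ) ∂μ := by
        refine lintegral_mono fun x => ?_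
        have hk := h.measurable_kernel_right ht x
        calc heatOscillation μ p f t x
            ≤ ∫⁻ z, (ENNReal.ofReal (p t x z) * ‖f x‖ₑ + ENNReal.ofReal (p t x z) * ‖f z‖ₑ) ∂μ := by
              refine lintegral_mono fun z => ?_
              rw [← mul_add, add_comm]
              exact mul_le_mul_right enorm_sub_le _
          _ = _ := by
              rw [lintegral_add_left (hk.mul_const _), lintegral_mul_const _ hk,
                h.lintegral_eq_one t ht, one_mul]
    _ = ∫⁻ x, ‖f x‖ₑ ∂μ + ∫⁻ z, ∫⁻ x, ENNReal.ofReal (p t x z) * ‖f z‖ₑ ∂μ ∂μ := by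
        rw [lintegral_add_left hf.enorm, lintegral_lintegral_swap m1.aemeasurable]
    _ = ∫⁻ x, ‖f x‖ₑ ∂μ + ∫⁻ x, ‖f x‖ₑ ∂μ := by
        congr 1
        refine lintegral_congr fun z => ?_
        rw [lintegral_mul_const _ (h.measurable_kernel_left ht z), h.lintegral_left_eq_one ht, one_mul]
    _ < ⊤ := ENNReal.add_lt_top.2 ⟨hf1, hf1⟩

end IsTransitionDensity

variable [BorelSpace X] [SecondCountableTopology X] [SigmaFinite μ]

theorem measurable_meanOscillation (hf : Measurable f) (s r : ℝ) :
    Measurable (meanOscillation μ s f r) := by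
  refine Measurable.const_mul ?_ _
  have e : ∀ y, ∫⁻ x in Metric.ball y r, ‖f x - f y‖ₑ ∂μ =
      ∫⁻ x, {q : X × X | dist q.2 q.1 < r}.indicator (fun q => ‖f q.2 - f q.1‖ₑ) (y, x) ∂μ := by
    intro y
    rw [← lintegral_indicator measurableSet_ball]
    rfl
  simp_rw [e]
  refine Measurable.lintegral_prod_right' (f := fun q : X × X =>
    {q : X × X | dist q.2 q.1 < r}.indicator (fun q => ‖f q.2 - f q.1‖ₑ) q) ?_
  refine Measurable.indicator ?_ ?_
  · exact ((hf.comp measurable_snd).sub (hf.comp measurable_fst)).enorm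
  · exact (isOpen_lt (continuous_snd.dist continuous_fst) continuous_const).measurableSet

theorem lintegral_oscillationMeasure (hf : Measurable f) (s r : ℝ) {φ : X → ℝ≥0∞}
    (hφ : Measurable φ) :
    ∫⁻ x, φ x ∂(oscillationMeasure μ s f r) = ∫⁻ x, φ x * meanOscillation μ s f r x ∂μ := by
  rw [oscillationMeasure, lintegral_withDensity_eq_lintegral_mul _
    (measurable_meanOscillation hf s r) hφ]
  exact lintegral_congr fun x => mul_comm _ _

end Oscillation

/-! ### Local bound of the heat energy by the mean oscillation -/

section LocalEstimate

variable {X : Type*} [MetricSpace X] [MeasurableSpace X] [BorelSpace X]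
  [SecondCountableTopology X] {μ : Measure X} {p : ℝ → X → X → ℝ} {f : X → ℝ}
  {dH dW c₃ c₄ c₅ c₆ : ℝ} {M : ℕ} {K b : ℝ}

/-- Inside the ball of radius `r = (A t)^(1/dW)` use the on-diagonal bound, outside it the tail
comparison. The coefficient is `c₃ t^(-dH/dW) r^s`, which undoes the normalisation `r^(-s)` of the
mean oscillation. -/
theorem heatOscillation_le_near_add_far (h : IsTransitionDensity μ p) (hf : Measurable f)
    (hb : PointwiseBounds p dH dW c₃ c₄ c₅ c₆)
    (hM : 1 ≤ M) (hdW : 2 ≤ dW) {A ε : ℝ} (hA : 0 < A) (hε : 0 < ε)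
    (htail : ∀ t : ℝ, 0 < t → ∀ x y : X,
      (A * t) ^ (1 / dW) ≤ dist x y → p t x y ≤ ε * p (M * t) x y)
    (s : ℝ) {t : ℝ} (ht : 0 < t) (x : X) :
    heatOscillation μ p f t x ≤
      ENNReal.ofReal (c₃ * A ^ (s / dW) * t ^ ((s - dH) / dW)) *
        meanOscillation μ s f ((A * t) ^ (1 / dW)) x +
      ENNReal.ofReal ε * heatOscillation μ p f (M * t) x := by
  have hM0 : (0 : ℝ) < M := by exact_mod_cast hM
  have h3 := hb.pos₃
  have hW : 0 < dW := by linarith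
  set r := (A * t) ^ (1 / dW) with hr
  have hr0 : 0 < r := by positivity
  have hm : Measurable (fun z => ‖f z - f x‖ₑ) := (hf.sub_const _).enorm
  have hconst : ENNReal.ofReal (c₃ * A ^ (s / dW) * t ^ ((s - dH) / dW)) *
        meanOscillation μ s f r x =
      ∫⁻ z, (Metric.ball x r).indicator
        (fun z => ENNReal.ofReal (c₃ * t ^ (-dH / dW)) * ‖f z - f x‖ₑ) z ∂μ := by
    rw [lintegral_indicator measurableSet_ball, lintegral_const_mul _ hm, meanOscillation,
      ← mul_assoc, ← ENNReal.ofReal_mul (by positivity)]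
    congr 2
    have e1 : r ^ (-s) = A ^ (-(s / dW)) * t ^ (-(s / dW)) := by
      rw [hr, ← Real.rpow_mul (by positivity), Real.mul_rpow hA.le ht.le,
        show 1 / dW * -s = -(s / dW) by ring]
    have e2 : A ^ (s / dW) * A ^ (-(s / dW)) = 1 := by
      rw [← Real.rpow_add hA, add_neg_cancel, Real.rpow_zero]
    have e3 : t ^ ((s - dH) / dW) * t ^ (-(s / dW)) = t ^ (-dH / dW) := by
      rw [← Real.rpow_add ht]; congr 1; ring
    rw [e1]
    calc _ = c₃ * (A ^ (s / dW) * A ^ (-(s / dW))) * (t ^ ((s - dH) / dW) * t ^ (-(s / dW))) := by ring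
      _ = _ := by rw [e2, e3, mul_one]
  have hkM := h.measurable_kernel_right (mul_pos hM0 ht) x
  rw [hconst, heatOscillation, heatOscillation, ← lintegral_const_mul _ (hkM.fun_mul hm),
    ← lintegral_add_left ((hm.const_mul _).indicator measurableSet_ball)]
  refine lintegral_mono fun z => ?_
  by_cases hz : z ∈ Metric.ball x r
  · rw [indicator_of_mem hz]
    refine le_add_right ?_
    gcongr
    exact hb.le_diag ht x z
  · rw [indicator_of_notMem hz, zero_add, ← mul_assoc, ← ENNReal.ofReal_mul hε.le]
    gcongr
    refine htail t ht x z ?_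
    rw [Metric.mem_ball', not_lt] at hz
    exact hz

theorem le_two_mul_of_le_add_half {a b : ℝ≥0∞} (ha : a ≠ ⊤)
    (h : a ≤ b + ENNReal.ofReal (1 / 2) * a) : a ≤ 2 * b := by
  rcases eq_or_ne b ⊤ with rfl | hb
  · simp
  lift a to ℝ≥0 using ha
  lift b to ℝ≥0 using hb
  have e : ENNReal.ofReal (1 / 2) = ((1 / 2 : ℝ≥0) : ℝ≥0∞) := by
    rw [ENNReal.ofReal]
    congr 1
    ext
    simp
  rw [e] at h
  norm_cast at h ⊢
  rw [← NNReal.coe_le_coe] at h ⊢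
  push_cast at h ⊢
  linarith

/-- The heat energy `∫ p_t(x, z) (f(z) - f(x))² dμ(z)` at `x`. -/
noncomputable def heatEnergy (μ : Measure X) (p : ℝ → X → X → ℝ) (f : X → ℝ) (t : ℝ) (x : X) :
    ℝ≥0∞ :=
  ∫⁻ z, ENNReal.ofReal (p t x z) * ‖f z - f x‖ₑ ^ 2 ∂μ

/-- Here the Hölder norm enters, and only linearly: one factor of the square is estimated by it, the
other is kept, and the kernel at time `M t` pays for `d^κ`. -/
theorem heatEnergy_le (h : IsTransitionDensity μ p) (hf : Measurable f) {κ H : ℝ≥0}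
    (hH : HolderWith H κ f) (hM : 1 ≤ M) {D : ℝ} (hD : 0 < D)
    (hmom : ∀ t : ℝ, 0 < t → ∀ x y : X,
      p t x y * dist x y ^ (κ : ℝ) ≤ D * t ^ (κ / dW) * p (M * t) x y) {t : ℝ} (ht : 0 < t) (x : X) :
    heatEnergy μ p f t x ≤
      H * ENNReal.ofReal (D * t ^ (κ / dW)) * heatOscillation μ p f (M * t) x := by
  have hM0 : (0 : ℝ) < M := by exact_mod_cast hM
  rw [heatOscillation, ← lintegral_const_mul _
    ((h.measurable_kernel_right (mul_pos hM0 ht) x).fun_mul (hf.sub_const _).enorm)]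
  refine lintegral_mono fun z => ?_
  have h1 : ‖f z - f x‖ₑ ≤ H * ENNReal.ofReal (dist x z ^ (κ : ℝ)) := by
    rw [← edist_eq_enorm_sub, edist_comm, ← ENNReal.ofReal_rpow_of_nonneg dist_nonneg κ.coe_nonneg,
      ← edist_dist]
    exact hH x z
  calc ENNReal.ofReal (p t x z) * ‖f z - f x‖ₑ ^ 2
      ≤ ENNReal.ofReal (p t x z) * (H * ENNReal.ofReal (dist x z ^ (κ : ℝ)) * ‖f z - f x‖ₑ) := by
        rw [sq]; gcongr
    _ = H * ENNReal.ofReal (p t x z * dist x z ^ (κ : ℝ)) * ‖f z - f x‖ₑ := by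
        rw [ENNReal.ofReal_mul (h.nonneg t ht x z)]; ring
    _ ≤ H * ENNReal.ofReal (D * t ^ (κ / dW) * p (M * t) x z) * ‖f z - f x‖ₑ := by
        exact mul_le_mul_left (mul_le_mul_right (ENNReal.ofReal_le_ofReal (hmom t ht x z)) _) _
    _ = _ := by rw [ENNReal.ofReal_mul (by positivity)]; ring

variable [SigmaFinite μ]

/-- Time `M t` costs at most `M` times time `t`, up to `δ`, so the factor `1 / (2 M)` makes the far
part at most half of the left side, plus half of the error. Since the left side is finite, half of
it can be subtracted. -/
theorem lintegral_heatOscillation_absorb (h : IsTransitionDensity μ p) (hf : Measurable f)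
    (hf1 : ∫⁻ x, ‖f x‖ₑ ∂μ < ⊤)
    (hM : 1 ≤ M) {t : ℝ} (ht : 0 < t) {N : X → ℝ≥0∞} (hN : Measurable N)
    (hnear : ∀ x, heatOscillation μ p f t x ≤
      N x + ENNReal.ofReal (1 / (2 * M)) * heatOscillation μ p f (M * t) x)
    {φ : X → ℝ≥0∞} (hφ : Measurable φ) (hφ1 : ∀ x, φ x ≤ 1) {δ : ℝ≥0∞}
    (hδ : ∀ s, 0 < s → s ≤ M * t → ∀ z, ∫⁻ x, ENNReal.ofReal (p s x z) * φ x ∂μ ≤ φ z + δ) :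
    ∫⁻ x, φ x * heatOscillation μ p f t x ∂μ ≤
      2 * ∫⁻ x, φ x * N x ∂μ + δ * ∫⁻ x, heatOscillation μ p f t x ∂μ := by
  have hM0 : (0 : ℝ) < M := by exact_mod_cast hM
  have hmM := h.measurable_heatOscillation hf (mul_pos hM0 ht)
  set J := ∫⁻ x, φ x * heatOscillation μ p f t x ∂μ
  set J₁ := ∫⁻ x, heatOscillation μ p f t x ∂μ
  have hJ : J ≠ ⊤ := by
    refine ((lintegral_mono fun x => ?_).trans_lt
      (h.lintegral_heatOscillation_lt_top hf hf1 ht)).ne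
    exact mul_le_of_le_one_left zero_le (hφ1 x)
  have h1 : J ≤ ∫⁻ x, φ x * N x ∂μ + ENNReal.ofReal (1 / (2 * M)) *
      ∫⁻ x, φ x * heatOscillation μ p f (M * t) x ∂μ := by
    rw [← lintegral_const_mul _ (hφ.fun_mul hmM), ← lintegral_add_left (hφ.fun_mul hN)]
    refine lintegral_mono fun x => ?_
    refine (mul_le_mul_right (hnear x) _).trans_eq ?_
    ring
  have h2 := h.lintegral_heatOscillation_nat_mul_le hf hφ ht hδ hM le_rfl
  have e : ENNReal.ofReal (1 / (2 * M)) * M = ENNReal.ofReal (1 / 2) := by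
    rw [← ENNReal.ofReal_natCast, ← ENNReal.ofReal_mul (by positivity)]
    congr 1
    field_simp
  have e2 : 2 * ENNReal.ofReal (1 / 2) = 1 := by
    rw [← ENNReal.ofReal_ofNat, ← ENNReal.ofReal_mul (by positivity)]
    norm_num
  have h3 : J ≤ (∫⁻ x, φ x * N x ∂μ + ENNReal.ofReal (1 / 2) * (δ * J₁)) +
      ENNReal.ofReal (1 / 2) * J := by
    refine (h1.trans (add_le_add le_rfl (mul_le_mul_right h2 _))).trans_eq ?_
    rw [← mul_assoc, e]
    ring
  refine (le_two_mul_of_le_add_half hJ h3).trans_eq ?_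
  rw [mul_add, ← mul_assoc 2 (ENNReal.ofReal _), e2, one_mul]

/-- The constants are fixed before `f`, `φ` and `t`, which makes the final constant independent of
`f`. -/
theorem exists_lintegral_heatEnergy_le (h : IsTransitionDensity μ p)
    (hb : PointwiseBounds p dH dW c₃ c₄ c₅ c₆) (hdW : 2 ≤ dW) {κ : ℝ≥0} (hκ : 0 < κ) :
    ∃ (A : ℝ) (C : ℝ≥0) (D : ℝ), 0 < A ∧ 0 < C ∧ 0 < D ∧ ∀ (f : X → ℝ) (H : ℝ≥0),
      HolderWith H κ f → ∫⁻ x, ‖f x‖ₑ ∂μ < ⊤ → ∀ (φ : X → ℝ≥0) (L : ℝ≥0), LipschitzWith L φ →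
      (∀ x, φ x ≤ 1) → ∀ t : ℝ, 0 < t →
      ∫⁻ x, φ x * heatEnergy μ p f t x ∂μ ≤ ENNReal.ofReal t * (C * H *
        (∫⁻ x, φ x ∂(oscillationMeasure μ (dH + dW - κ) f ((A * t) ^ (1 / dW))) +
          L * ENNReal.ofReal (D * t ^ (1 / dW)) *
            oscillationMeasure μ (dH + dW - κ) f ((A * t) ^ (1 / dW)) univ)) := by
  obtain ⟨M, K, b, hc⟩ := hb.comparison hdW
  have hM := hc.one_le
  have hM0 : (0 : ℝ) < M := by exact_mod_cast hM
  have hW : 0 < dW := by linarith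
  have h3 := hb.pos₃
  obtain ⟨D₁, hD₁, hmom₁⟩ := hc.moment hdW zero_lt_one
  obtain ⟨Dκ, hDκ, hmomκ⟩ := hc.moment hdW (NNReal.coe_pos.2 hκ)
  obtain ⟨A, hA, htail⟩ := hc.tail hdW (ε := 1 / (2 * M)) (by positivity)
  set s := dH + dW - κ with hs
  set B := c₃ * A ^ (s / dW)
  have hB0 : 0 < B := by positivity
  -- The Hölder step contributes `Dκ`, iteration `M`, absorption `2`, and the near part `B`. The
  -- spreading error `δ` is counted twice, once in absorbing and once in iterating, relative to the
  -- main term.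
  refine ⟨A, (Dκ * (2 * (M * B))).toNNReal, 2 * (D₁ * (M : ℝ) ^ (1 / dW)), hA,
    Real.toNNReal_pos.2 (by positivity), by positivity, ?_⟩
  intro f H hH hf1 φ L hL hφ1 t ht
  have hfc : Continuous f := hH.continuous hκ
  have hf := hfc.measurable
  have hφm : Measurable (fun x => (φ x : ℝ≥0∞)) := hL.continuous.measurable.coe_nnreal_ennreal
  set r := (A * t) ^ (1 / dW)
  set N : X → ℝ≥0∞ := fun x =>
    ENNReal.ofReal (B * t ^ ((s - dH) / dW)) * meanOscillation μ s f r x with hNdef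
  have hmo := measurable_meanOscillation (μ := μ) hf s r
  have hN : Measurable N := hmo.const_mul _
  have hnear : ∀ x, heatOscillation μ p f t x ≤
      N x + ENNReal.ofReal (1 / (2 * M)) * heatOscillation μ p f (M * t) x := fun x =>
    heatOscillation_le_near_add_far h hf hb hM hdW hA (by positivity) htail s ht x
  set δ : ℝ≥0∞ := L * ENNReal.ofReal (D₁ * (M * t) ^ (1 / dW)) with hδdef
  have hδ : ∀ s, 0 < s → s ≤ M * t → ∀ z, ∫⁻ x, ENNReal.ofReal (p s x z) * φ x ∂μ ≤ φ z + δ := by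
    intro s hs hst z
    refine (h.lintegral_lipschitz_le hM hD₁ hmom₁ hL hs z).trans ?_
    rw [hδdef]
    gcongr
  set I := ∫⁻ x, φ x ∂(oscillationMeasure μ s f r) with hI
  set I₁ := oscillationMeasure μ s f r univ with hI₁
  have hNφ : ∫⁻ x, φ x * N x ∂μ = ENNReal.ofReal (B * t ^ ((s - dH) / dW)) * I := by
    rw [hI, lintegral_oscillationMeasure hf s r hφm, ← lintegral_const_mul _ (hφm.fun_mul hmo)]
    refine lintegral_congr fun x => ?_
    rw [hNdef]
    ring
  have hN1 : ∫⁻ x, 1 * N x ∂μ = ENNReal.ofReal (B * t ^ ((s - dH) / dW)) * I₁ := by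
    rw [hI₁, ← lintegral_one, lintegral_oscillationMeasure hf s r measurable_const,
      ← lintegral_const_mul _ (hmo.const_mul _)]
    refine lintegral_congr fun x => ?_
    rw [hNdef]
    ring
  -- The constant weight has no spreading error; this bounds the global oscillation that multiplies
  -- `δ`.
  have j1 := lintegral_heatOscillation_absorb h hf hf1 hM ht hN hnear (φ := fun _ => 1)
    measurable_const (fun _ => le_rfl) (δ := 0) (fun s hs _ z => by
      simp [h.lintegral_left_eq_one hs])
  have jφ := lintegral_heatOscillation_absorb h hf hf1 hM ht hN hnear hφm
    (fun x => by exact_mod_cast hφ1 x) hδ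
  have jM := h.lintegral_heatOscillation_nat_mul_le hf hφm ht hδ hM le_rfl
  rw [hN1] at j1
  simp only [one_mul, zero_mul, add_zero] at j1
  rw [hNφ] at jφ
  have hmM := h.measurable_heatOscillation hf (mul_pos hM0 ht)
  have step : ∫⁻ x, φ x * heatEnergy μ p f t x ∂μ ≤
      H * ENNReal.ofReal (Dκ * t ^ (κ / dW)) * ∫⁻ x, φ x * heatOscillation μ p f (M * t) x ∂μ := by
    rw [← lintegral_const_mul _ (hφm.fun_mul hmM)]
    refine lintegral_mono fun x => ?_
    refine (mul_le_mul_right (heatEnergy_le h hf hH hM hDκ hmomκ ht x) _).trans_eq ?_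
    ring
  set J := ∫⁻ x, φ x * heatOscillation μ p f t x ∂μ
  set J₁ := ∫⁻ x, heatOscillation μ p f t x ∂μ
  set P := ENNReal.ofReal (B * t ^ ((s - dH) / dW)) with hP
  -- The choice `s = dH + dW - κ` makes `t^(κ/dW) * t^((s-dH)/dW)` equal to `t`.
  have hPt : ENNReal.ofReal (Dκ * t ^ (κ / dW)) * (2 * (M * P)) =
      ENNReal.ofReal t * ((Dκ * (2 * (M * B))).toNNReal : ℝ≥0∞) := by
    have e : t ^ (κ / dW) * t ^ ((s - dH) / dW) = t := by
      rw [← Real.rpow_add ht, hs, ← add_div,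
        show ((κ : ℝ) + (dH + dW - κ - dH)) = dW by ring, div_self hW.ne', Real.rpow_one]
    rw [hP, ← ENNReal.ofReal_natCast, ← ENNReal.ofReal_ofNat, ← ENNReal.ofReal_mul (by positivity),
      ← ENNReal.ofReal_mul (by positivity), ← ENNReal.ofReal_mul (by positivity),
      show ((Dκ * (2 * (M * B))).toNNReal : ℝ≥0∞) = ENNReal.ofReal (Dκ * (2 * (M * B))) from rfl,
      ← ENNReal.ofReal_mul (by positivity)]
    congr 1
    calc _ = Dκ * (2 * (M * B)) * (t ^ (κ / dW) * t ^ ((s - dH) / dW)) := by ring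
      _ = _ := by rw [e]; ring
  have hδ2 : L * ENNReal.ofReal (2 * (D₁ * (M : ℝ) ^ (1 / dW)) * t ^ (1 / dW)) = 2 * δ := by
    rw [hδdef, Real.mul_rpow hM0.le ht.le, mul_left_comm (2 : ℝ≥0∞), ← ENNReal.ofReal_ofNat,
      ← ENNReal.ofReal_mul (by positivity)]
    congr 2
    ring
  calc ∫⁻ x, φ x * heatEnergy μ p f t x ∂μ
      ≤ H * ENNReal.ofReal (Dκ * t ^ (κ / dW)) * (M * (J + δ * J₁)) := step.trans (by gcongr)
    _ ≤ H * ENNReal.ofReal (Dκ * t ^ (κ / dW)) *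
          (M * ((2 * (P * I) + δ * (2 * (P * I₁))) + δ * (2 * (P * I₁)))) := by
        gcongr
        exact jφ.trans (by gcongr)
    _ = H * (ENNReal.ofReal (Dκ * t ^ (κ / dW)) * (2 * (M * P))) * (I + 2 * δ * I₁) := by ring
    _ = _ := by rw [hPt, hδ2]; ring

end LocalEstimate

/-! ### The joint law of the heat kernel and the approximating forms -/

section ApproximatingForm

variable {X : Type*} [MeasurableSpace X]

/-- The joint law `p_t(x, y) dμ(x) dμ(y)`. -/
noncomputable def jointMeasure (μ : Measure X) (p : ℝ → X → X → ℝ) (t : ℝ) : Measure (X × X) :=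
  (μ.prod μ).withDensity fun q => ENNReal.ofReal (p t q.1 q.2)

/-- The approximating form `(2t)⁻¹ ∫∫ p_t(x, y) (f(y) - f(x)) (g(y) - g(x)) dμ(x) dμ(y)`. -/
noncomputable def approxForm (μ : Measure X) (p : ℝ → X → X → ℝ) (t : ℝ) (f g : X → ℝ) : ℝ :=
  (2 * t)⁻¹ * ∫ q, (f q.2 - f q.1) * (g q.2 - g q.1) ∂(jointMeasure μ p t)

variable [MetricSpace X] [BorelSpace X] [SecondCountableTopology X]
  {μ : Measure X} [SigmaFinite μ] {p : ℝ → X → X → ℝ} {f g : X → ℝ} {t : ℝ}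

namespace IsTransitionDensity

theorem lintegral_joint (h : IsTransitionDensity μ p) (ht : 0 < t) {F : X × X → ℝ≥0∞}
    (hF : Measurable F) : ∫⁻ q, F q ∂(jointMeasure μ p t) =
      ∫⁻ x, ∫⁻ y, ENNReal.ofReal (p t x y) * F (x, y) ∂μ ∂μ := by
  rw [jointMeasure, lintegral_withDensity_eq_lintegral_mul _ (h.measurable_kernel ht) hF,
    lintegral_prod _ ((h.measurable_kernel ht).mul hF).aemeasurable]
  rfl

/-- Conservativeness in terms of the joint law: its first marginal is `μ`. With the symmetry under
swapping, every L² function of either variable is L² for the joint law. -/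
theorem measurePreserving_fst (h : IsTransitionDensity μ p) (ht : 0 < t) :
    MeasurePreserving Prod.fst (jointMeasure μ p t) μ := by
  refine ⟨measurable_fst, ?_⟩
  refine Measure.ext_of_lintegral _ fun F hF => ?_
  rw [lintegral_map hF measurable_fst, h.lintegral_joint ht (F := fun q => F q.1) (hF.comp measurable_fst)]
  refine lintegral_congr fun x => ?_
  change ∫⁻ y, ENNReal.ofReal (p t x y) * F x ∂μ = F x
  rw [lintegral_mul_const _ (h.measurable_kernel_right ht x), h.lintegral_eq_one t ht, one_mul]

theorem measurePreserving_swap (h : IsTransitionDensity μ p) (ht : 0 < t) :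
    MeasurePreserving Prod.swap (jointMeasure μ p t) (jointMeasure μ p t) := by
  refine ⟨measurable_swap, ?_⟩
  refine Measure.ext_of_lintegral _ fun F hF => ?_
  rw [lintegral_map hF measurable_swap, h.lintegral_joint ht (F := fun q => F q.swap) (hF.comp measurable_swap),
    h.lintegral_joint ht hF, lintegral_lintegral_swap]
  · refine lintegral_congr fun x => lintegral_congr fun y => ?_
    rw [h.symm t ht]
    rfl
  · exact ((h.measurable_kernel ht).fun_mul (hF.comp measurable_swap)).aemeasurable

theorem measurePreserving_snd (h : IsTransitionDensity μ p) (ht : 0 < t) :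
    MeasurePreserving Prod.snd (jointMeasure μ p t) μ :=
  (h.measurePreserving_fst ht).comp (h.measurePreserving_swap ht)

theorem integral_joint_swap (h : IsTransitionDensity μ p) (ht : 0 < t) (F : X × X → ℝ) :
    ∫ q, F q.swap ∂(jointMeasure μ p t) = ∫ q, F q ∂(jointMeasure μ p t) :=
  (h.measurePreserving_swap ht).integral_comp MeasurableEquiv.prodComm.measurableEmbedding F

theorem memLp_sub (h : IsTransitionDensity μ p) (ht : 0 < t) (hf : MemLp f 2 μ) :
    MemLp (fun q : X × X => f q.2 - f q.1) 2 (jointMeasure μ p t) :=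
  (hf.comp_measurePreserving (h.measurePreserving_snd ht)).sub
    (hf.comp_measurePreserving (h.measurePreserving_fst ht))

theorem integrable_sub_mul_sub (h : IsTransitionDensity μ p) (ht : 0 < t) (hf : MemLp f 2 μ)
    (hg : MemLp g 2 μ) :
    Integrable (fun q : X × X => (f q.2 - f q.1) * (g q.2 - g q.1)) (jointMeasure μ p t) :=
  (h.memLp_sub ht hf).integrable_mul (h.memLp_sub ht hg)

theorem integral_cross (h : IsTransitionDensity μ p) (ht : 0 < t) (hf : MemLp f 2 μ)
    (hg : MemLp g 2 μ) :
    ∫ q, f q.2 * g q.1 ∂(jointMeasure μ p t) = ∫ x, (∫ y, p t x y * f y ∂μ) * g x ∂μ := by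
  have hint : Integrable (fun q : X × X => f q.2 * g q.1) (jointMeasure μ p t) :=
    (hf.comp_measurePreserving (h.measurePreserving_snd ht)).integrable_mul
      (hg.comp_measurePreserving (h.measurePreserving_fst ht))
  have hlt : ∀ᵐ q ∂(μ.prod μ), ENNReal.ofReal (p t q.1 q.2) < ⊤ :=
    ae_of_all _ fun q => ENNReal.ofReal_lt_top
  rw [jointMeasure, integrable_withDensity_iff_integrable_smul' (h.measurable_kernel ht) hlt] at hint
  rw [jointMeasure, integral_withDensity_eq_integral_toReal_smul (h.measurable_kernel ht) hlt,
    integral_prod _ hint]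
  refine integral_congr_ae (ae_of_all _ fun x => ?_)
  simp only
  rw [← integral_mul_const]
  refine integral_congr_ae (ae_of_all _ fun y => ?_)
  simp only [smul_eq_mul]
  rw [ENNReal.toReal_ofReal (h.nonneg t ht x y), mul_assoc]

/-- Expand the product of increments. The two diagonal terms agree because both marginals are `μ`,
the two cross terms because the law is symmetric; the resulting factor `2` cancels the one in
`(2t)⁻¹`. -/
theorem approxForm_eq (h : IsTransitionDensity μ p) {P : ℝ → Lp ℝ 2 μ →L[ℝ] Lp ℝ 2 μ}
    (hker : ∀ t : ℝ, 0 < t → ∀ u : Lp ℝ 2 μ,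
      (P t u : X → ℝ) =ᵐ[μ] fun x => ∫ y, p t x y * u y ∂μ)
    (ht : 0 < t) (hf : MemLp f 2 μ) (hg : MemLp g 2 μ) :
    approxForm μ p t f g = t⁻¹ * inner ℝ (hf.toLp f - P t (hf.toLp f)) (hg.toLp g) := by
  have hf1 := hf.comp_measurePreserving (h.measurePreserving_fst ht)
  have hf2 := hf.comp_measurePreserving (h.measurePreserving_snd ht)
  have hg1 := hg.comp_measurePreserving (h.measurePreserving_fst ht)
  have hg2 := hg.comp_measurePreserving (h.measurePreserving_snd ht)
  have i11 : Integrable (fun q => f q.1 * g q.1) (jointMeasure μ p t) := hf1.integrable_mul hg1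
  have i12 : Integrable (fun q => f q.1 * g q.2) (jointMeasure μ p t) := hf1.integrable_mul hg2
  have i21 : Integrable (fun q => f q.2 * g q.1) (jointMeasure μ p t) := hf2.integrable_mul hg1
  have i22 : Integrable (fun q => f q.2 * g q.2) (jointMeasure μ p t) := hf2.integrable_mul hg2
  have e11 : ∫ q, f q.1 * g q.1 ∂(jointMeasure μ p t) = ∫ x, f x * g x ∂μ := by
    have hm := (h.measurePreserving_fst ht)
    have hs : AEStronglyMeasurable (fun x => f x * g x) μ := hf.1.mul hg.1
    have := integral_map (φ := Prod.fst) (μ := jointMeasure μ p t) hm.measurable.aemeasurable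
      (hm.map_eq.symm ▸ hs)
    rw [hm.map_eq] at this
    exact this.symm
  have e22 : ∫ q, f q.2 * g q.2 ∂(jointMeasure μ p t) = ∫ x, f x * g x ∂μ := by
    rw [← e11, ← h.integral_joint_swap ht]
    rfl
  have e12 : ∫ q, f q.1 * g q.2 ∂(jointMeasure μ p t) = ∫ q, f q.2 * g q.1 ∂(jointMeasure μ p t) := by
    rw [← h.integral_joint_swap ht]
    rfl
  have e : ∫ q, (f q.2 - f q.1) * (g q.2 - g q.1) ∂(jointMeasure μ p t) =
      2 * (∫ x, f x * g x ∂μ - ∫ x, (∫ y, p t x y * f y ∂μ) * g x ∂μ) := by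
    have : (fun q : X × X => (f q.2 - f q.1) * (g q.2 - g q.1)) = fun q =>
        (f q.2 * g q.2 - f q.2 * g q.1) - (f q.1 * g q.2 - f q.1 * g q.1) := by
      ext q; ring
    rw [this]
    have s1 : Integrable (fun q : X × X => f q.2 * g q.2 - f q.2 * g q.1) (jointMeasure μ p t) :=
      i22.sub i21
    have s2 : Integrable (fun q : X × X => f q.1 * g q.2 - f q.1 * g q.1) (jointMeasure μ p t) :=
      i12.sub i11
    rw [integral_sub s1 s2, integral_sub i22 i21, integral_sub i12 i11, e11, e22, e12,
      h.integral_cross ht hf hg]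
    ring
  have e3 : inner ℝ (hf.toLp f - P t (hf.toLp f)) (hg.toLp g) =
      ∫ x, f x * g x ∂μ - ∫ x, (∫ y, p t x y * f y ∂μ) * g x ∂μ := by
    rw [inner_sub_left, L2.inner_def, L2.inner_def]
    congr 1
    · refine integral_congr_ae ?_
      filter_upwards [hf.coeFn_toLp, hg.coeFn_toLp] with x h1 h2
      rw [h1, h2]
      simp [mul_comm]
    · refine integral_congr_ae ?_
      filter_upwards [hker t ht (hf.toLp f), hg.coeFn_toLp] with x h1 h2
      have : ∫ y, p t x y * hf.toLp f y ∂μ = ∫ y, p t x y * f y ∂μ := by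
        refine integral_congr_ae ?_
        filter_upwards [hf.coeFn_toLp] with y hy
        rw [hy]
      rw [h1, h2, this]
      simp [mul_comm]
  rw [approxForm, e, e3, mul_inv]
  ring

end IsTransitionDensity

end ApproximatingForm

/-! ### Convergence of the approximating forms to the Dirichlet form -/

namespace DirichletForm

variable {X : Type*} [MeasurableSpace X] {μ : Measure X} {E : DirichletForm μ}
  {P : ℝ → Lp ℝ 2 μ →L[ℝ] Lp ℝ 2 μ}

/-- Polarisation of the convergence on the diagonal, by symmetry of `P_t` and of the form. -/
theorem IsHeatSemigroup.tendsto_inner (hP : E.IsHeatSemigroup P) (u v : E.domain) :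
    Tendsto (fun t : ℝ => t⁻¹ * inner ℝ ((u : Lp ℝ 2 μ) - P t u) (v : Lp ℝ 2 μ)) (𝓝[>] 0)
      (𝓝 (E.form u v)) := by
  have h1 := ((hP.tendsto_form (u + v)).sub ((hP.tendsto_form u).add
    (hP.tendsto_form v))).const_mul (1 / 2)
  have e : 1 / 2 * (E.form (u + v) (u + v) - (E.form u u + E.form v v)) = E.form u v := by
    simp only [map_add, LinearMap.add_apply, E.symm v u]
    ring
  rw [e] at h1
  refine h1.congr' ?_
  filter_upwards [self_mem_nhdsWithin] with t ht
  have hs : inner ℝ (P t u) (v : Lp ℝ 2 μ) = inner ℝ (P t v) (u : Lp ℝ 2 μ) := by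
    rw [hP.symm t (le_of_lt ht), real_inner_comm]
  have hs' : inner ℝ (v : Lp ℝ 2 μ) (u : Lp ℝ 2 μ) = inner ℝ (u : Lp ℝ 2 μ) (v : Lp ℝ 2 μ) :=
    real_inner_comm _ _
  simp only [Submodule.coe_add, map_add, inner_sub_left, inner_add_left, inner_add_right]
  rw [← hs, hs']
  ring

theorem val_eq {f g : X → ℝ} (hf : MemLp f 2 μ) (hfd : hf.toLp f ∈ E.domain) (hg : MemLp g 2 μ)
    (hgd : hg.toLp g ∈ E.domain) :
    E.val f g = E.form ⟨hf.toLp f, hfd⟩ ⟨hg.toLp g, hgd⟩ := by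
  have h : E.Mem f ∧ E.Mem g := ⟨⟨hf, hfd⟩, ⟨hg, hgd⟩⟩
  rw [val, dif_pos h]

end DirichletForm

section FormLimit

variable {X : Type*} [MetricSpace X] [MeasurableSpace X] [BorelSpace X]
  [SecondCountableTopology X] {μ : Measure X} [SigmaFinite μ] {p : ℝ → X → X → ℝ} {f g : X → ℝ}
  {E : DirichletForm μ}

/-- `p` is a transition density whose approximating forms determine the Dirichlet form `E`. -/
structure IsFormDensity (E : DirichletForm μ) (p : ℝ → X → X → ℝ) : Prop where
  density : IsTransitionDensity μ p
  mem_iff : ∀ f : X → ℝ, E.Mem f ↔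
    MemLp f 2 μ ∧ ∃ B : ℝ, ∀ t : ℝ, 0 < t → approxForm μ p t f f ≤ B
  tendsto_val : ∀ f g : X → ℝ, E.Mem f → E.Mem g →
    Tendsto (fun t => approxForm μ p t f g) (𝓝[>] 0) (𝓝 (E.val f g))

theorem IsTransitionDensity.isFormDensity (h : IsTransitionDensity μ p)
    {P : ℝ → Lp ℝ 2 μ →L[ℝ] Lp ℝ 2 μ} (hP : E.IsHeatSemigroup P)
    (hker : ∀ t : ℝ, 0 < t → ∀ u : Lp ℝ 2 μ,
      (P t u : X → ℝ) =ᵐ[μ] fun x => ∫ y, p t x y * u y ∂μ) : IsFormDensity E p := by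
  refine ⟨h, fun f => ?_, fun f g hf hg => ?_⟩
  · constructor
    · rintro ⟨hf, hd⟩
      obtain ⟨B, hB⟩ := (hP.mem_domain_iff _).1 hd
      refine ⟨hf, B, fun t ht => ?_⟩
      rw [h.approxForm_eq hker ht hf hf]
      exact hB ⟨t, ht, rfl⟩
    · rintro ⟨hf, B, hB⟩
      refine ⟨hf, (hP.mem_domain_iff _).2 ⟨B, ?_⟩⟩
      rintro _ ⟨t, ht, rfl⟩
      have := hB t ht
      rwa [h.approxForm_eq hker ht hf hf] at this
  · obtain ⟨hf, hfd⟩ := hf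
    obtain ⟨hg, hgd⟩ := hg
    rw [DirichletForm.val_eq hf hfd hg hgd]
    refine (hP.tendsto_inner ⟨_, hfd⟩ ⟨_, hgd⟩).congr' ?_
    filter_upwards [self_mem_nhdsWithin] with t ht
    rw [h.approxForm_eq hker ht hf hg]

/-- A contraction principle: the approximating forms are monotone in the squared increments, and
their boundedness characterises the domain. Squares, products and soft thresholds are handled by it.
-/
theorem IsFormDensity.mem_of_sq_le (h : IsFormDensity E p) {f₁ f₂ : X → ℝ} (h₁ : E.Mem f₁)
    (h₂ : E.Mem f₂) (hg : MemLp g 2 μ) {a b : ℝ} (ha : 0 ≤ a) (hb : 0 ≤ b)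
    (hle : ∀ x y, (g y - g x) ^ 2 ≤ a * (f₁ y - f₁ x) ^ 2 + b * (f₂ y - f₂ x) ^ 2) : E.Mem g := by
  obtain ⟨m₁, B₁, hB₁⟩ := (h.mem_iff f₁).1 h₁
  obtain ⟨m₂, B₂, hB₂⟩ := (h.mem_iff f₂).1 h₂
  refine (h.mem_iff g).2 ⟨hg, a * B₁ + b * B₂, fun t ht => ?_⟩
  have i₁ := (h.density.integrable_sub_mul_sub ht m₁ m₁).const_mul a
  have i₂ := (h.density.integrable_sub_mul_sub ht m₂ m₂).const_mul b
  have hI : ∫ q, (g q.2 - g q.1) * (g q.2 - g q.1) ∂(jointMeasure μ p t) ≤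
      a * ∫ q, (f₁ q.2 - f₁ q.1) * (f₁ q.2 - f₁ q.1) ∂(jointMeasure μ p t) +
      b * ∫ q, (f₂ q.2 - f₂ q.1) * (f₂ q.2 - f₂ q.1) ∂(jointMeasure μ p t) := by
    rw [← integral_const_mul, ← integral_const_mul, ← integral_add i₁ i₂]
    refine integral_mono (h.density.integrable_sub_mul_sub ht hg hg) (i₁.add i₂) fun q => ?_
    have := hle q.1 q.2
    simp only
    nlinarith
  have b₁ := mul_le_mul_of_nonneg_left (hB₁ t ht) ha
  have b₂ := mul_le_mul_of_nonneg_left (hB₂ t ht) hb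
  have ht2 : 0 ≤ (2 * t)⁻¹ := by positivity
  have := mul_le_mul_of_nonneg_left hI ht2
  unfold approxForm at *
  nlinarith

end FormLimit

/-! ### Existence and uniqueness of the energy measure -/

section EnergyMeasure

variable {X : Type*} [MeasurableSpace X]

theorem measurable_sq_density {X : Type*} [MeasurableSpace X] {f : X → ℝ} (hf : Measurable f) (t : ℝ) :
    Measurable (fun q : X × X => ENNReal.ofReal ((2 * t)⁻¹ * (f q.2 - f q.1) ^ 2)) :=
  ((((hf.comp measurable_snd).sub (hf.comp measurable_fst)).pow_const 2).const_mul _).ennreal_ofReal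

/-- The approximating energy measure `(2t)⁻¹ ∫ p_t(x, y) (f(y) - f(x))² dμ(y) dμ(x)`. -/
noncomputable def approxEnergyMeasure (μ : Measure X) (p : ℝ → X → X → ℝ) (f : X → ℝ) (t : ℝ) :
    Measure X :=
  ((jointMeasure μ p t).withDensity fun q =>
    ENNReal.ofReal ((2 * t)⁻¹ * (f q.2 - f q.1) ^ 2)).map Prod.fst

theorem integral_approxEnergyMeasure {X : Type*} [MeasurableSpace X] {μ : Measure X}
    {p : ℝ → X → X → ℝ} {f φ : X → ℝ} {t : ℝ} (ht : 0 < t) (hf : Measurable f) (hφ : Measurable φ) :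
    ∫ x, φ x ∂(approxEnergyMeasure μ p f t) =
      (2 * t)⁻¹ * ∫ q, φ q.1 * (f q.2 - f q.1) ^ 2 ∂(jointMeasure μ p t) := by
  rw [approxEnergyMeasure, integral_map measurable_fst.aemeasurable hφ.aestronglyMeasurable,
    integral_withDensity_eq_integral_toReal_smul (measurable_sq_density hf t)
      (ae_of_all _ fun q => ENNReal.ofReal_lt_top), ← integral_const_mul]
  refine integral_congr_ae (ae_of_all _ fun q => ?_)
  simp only [smul_eq_mul]
  rw [ENNReal.toReal_ofReal (by positivity)]
  ring

variable [MetricSpace X] [BorelSpace X] [SecondCountableTopology X]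
  {μ : Measure X} [SigmaFinite μ] {p : ℝ → X → X → ℝ} {f φ : X → ℝ} {t : ℝ}
  {E : DirichletForm μ}

theorem lintegral_approxEnergyMeasure (h : IsTransitionDensity μ p) (ht : 0 < t)
    (hf : Measurable f) {φ : X → ℝ≥0∞} (hφ : Measurable φ) :
    ∫⁻ x, φ x ∂(approxEnergyMeasure μ p f t) =
      ENNReal.ofReal (2 * t)⁻¹ * ∫⁻ x, φ x * heatEnergy μ p f t x ∂μ := by
  have hm := measurable_sq_density hf t
  have hq : Measurable (fun q : X × X => ENNReal.ofReal (p t q.1 q.2) * ‖f q.2 - f q.1‖ₑ ^ 2) :=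
    (h.measurable_kernel ht).fun_mul
      (((hf.comp measurable_snd).sub (hf.comp measurable_fst)).enorm.pow_const 2)
  have hE : Measurable (heatEnergy μ p f t) := hq.lintegral_prod_right'
  have hmφ : Measurable (fun q : X × X =>
      ENNReal.ofReal ((2 * t)⁻¹ * (f q.2 - f q.1) ^ 2) * φ q.1) :=
    hm.fun_mul (hφ.comp measurable_fst)
  rw [approxEnergyMeasure, lintegral_map hφ measurable_fst,
    lintegral_withDensity_eq_lintegral_mul _ hm (g := fun q => φ q.1) (hφ.comp measurable_fst)]
  refine (h.lintegral_joint ht hmφ).trans ?_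
  rw [← lintegral_const_mul _ (hφ.fun_mul hE)]
  refine lintegral_congr fun x => ?_
  have hqx : Measurable (fun y => ENNReal.ofReal (p t x y) * ‖f y - f x‖ₑ ^ 2) :=
    hq.comp measurable_prodMk_left
  rw [heatEnergy, ← lintegral_const_mul _ hqx, ← lintegral_const_mul]
  · refine lintegral_congr fun y => ?_
    rw [ENNReal.ofReal_mul (by positivity), Real.enorm_eq_ofReal_abs,
      ← ENNReal.ofReal_pow (abs_nonneg _), sq_abs]
    ring
  · exact hqx.const_mul _

theorem approxEnergyMeasure_univ (h : IsTransitionDensity μ p) (ht : 0 < t)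
    (hf2 : MemLp f 2 μ) :
    approxEnergyMeasure μ p f t univ = ENNReal.ofReal (approxForm μ p t f f) := by
  have e : ∀ q : X × X, (f q.2 - f q.1) * (f q.2 - f q.1) = (f q.2 - f q.1) ^ 2 := fun q => by ring
  have hint := h.integrable_sub_mul_sub ht hf2 hf2
  simp_rw [e] at hint
  rw [approxEnergyMeasure, Measure.map_apply measurable_fst MeasurableSet.univ, preimage_univ,
    withDensity_apply _ MeasurableSet.univ, setLIntegral_univ, approxForm, ← integral_const_mul]
  simp_rw [e]
  rw [ofReal_integral_eq_lintegral_ofReal (hint.const_mul _)]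
  exact ae_of_all _ fun q => by positivity

/-- The difference of the two integrands is `½ (φ(x) + φ(y)) (f(y) - f(x))²`, and the symmetry of
the joint law replaces the average of `φ(x)` and `φ(y)` by `φ(x)`. -/
theorem integral_approxEnergyMeasure_eq_approxForm (h : IsTransitionDensity μ p) (ht : 0 < t)
    (hf : Measurable f) (hφ : Measurable φ) (hf2 : MemLp f 2 μ) (hφ2 : MemLp φ 2 μ)
    (hff : MemLp (fun x => f x ^ 2) 2 μ) (hfφ : MemLp (fun x => f x * φ x) 2 μ)
    {B : ℝ} (hB : ∀ x, |φ x| ≤ B) :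
    ∫ x, φ x ∂(approxEnergyMeasure μ p f t) =
      approxForm μ p t (fun x => f x * φ x) f - 1 / 2 * approxForm μ p t φ (fun x => f x ^ 2) := by
  have e : ∀ q : X × X, (f q.2 - f q.1) * (f q.2 - f q.1) = (f q.2 - f q.1) ^ 2 := fun q => by ring
  have hint := h.integrable_sub_mul_sub ht hf2 hf2
  simp_rw [e] at hint
  have i1 : Integrable (fun q : X × X => φ q.1 * (f q.2 - f q.1) ^ 2) (jointMeasure μ p t) :=
    hint.bdd_mul (c := B) (hφ.comp measurable_fst).aestronglyMeasurable
      (ae_of_all _ fun q => hB q.1)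
  have i2 : Integrable (fun q : X × X => φ q.2 * (f q.2 - f q.1) ^ 2) (jointMeasure μ p t) :=
    hint.bdd_mul (c := B) (hφ.comp measurable_snd).aestronglyMeasurable
      (ae_of_all _ fun q => hB q.2)
  have hsw : ∫ q, φ q.2 * (f q.2 - f q.1) ^ 2 ∂(jointMeasure μ p t) =
      ∫ q, φ q.1 * (f q.2 - f q.1) ^ 2 ∂(jointMeasure μ p t) := by
    rw [← h.integral_joint_swap ht]
    refine integral_congr_ae (ae_of_all _ fun q => ?_)
    simp only [Prod.fst_swap, Prod.snd_swap]
    ring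
  have j1 := h.integrable_sub_mul_sub ht hfφ hf2
  have j2 := h.integrable_sub_mul_sub ht hφ2 hff
  have key : ∫ q, (f q.2 * φ q.2 - f q.1 * φ q.1) * (f q.2 - f q.1) ∂(jointMeasure μ p t) -
      1 / 2 * ∫ q, (φ q.2 - φ q.1) * (f q.2 ^ 2 - f q.1 ^ 2) ∂(jointMeasure μ p t) =
      ∫ q, φ q.1 * (f q.2 - f q.1) ^ 2 ∂(jointMeasure μ p t) := by
    rw [← integral_const_mul, ← integral_sub j1 (j2.const_mul _)]
    have : ∀ q : X × X, (f q.2 * φ q.2 - f q.1 * φ q.1) * (f q.2 - f q.1) -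
        1 / 2 * ((φ q.2 - φ q.1) * (f q.2 ^ 2 - f q.1 ^ 2)) =
        1 / 2 * (φ q.1 * (f q.2 - f q.1) ^ 2 + φ q.2 * (f q.2 - f q.1) ^ 2) := fun q => by ring
    simp_rw [this]
    rw [integral_const_mul, integral_add i1 i2, hsw]
    ring
  rw [integral_approxEnergyMeasure ht hf hφ, approxForm, approxForm, ← key]
  ring

namespace IsFormDensity

theorem mem_sq (h : IsFormDensity E p) (hf : Measurable f) (hmem : E.Mem f) {B : ℝ}
    (hB : ∀ x, |f x| ≤ B) : E.Mem (fun x => f x ^ 2) := by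
  have hf2 := ((h.mem_iff f).1 hmem).1
  have hL : MemLp (fun x => f x ^ 2) 2 μ := by
    refine (hf2.const_mul B).mono (hf.pow_const 2).aestronglyMeasurable (ae_of_all _ fun x => ?_)
    rw [norm_pow, norm_mul, sq]
    refine mul_le_mul_of_nonneg_right ((hB x).trans (le_abs_self _)) (norm_nonneg _)
  refine h.mem_of_sq_le hmem hmem hL (a := 4 * B ^ 2) (b := 0) (by positivity) le_rfl
    fun x y => ?_
  have h1 : (f y + f x) ^ 2 ≤ 4 * B ^ 2 := by
    have hx := abs_le.1 (hB x)
    have hy := abs_le.1 (hB y)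
    have : |f y + f x| ≤ 2 * B := abs_le.2 ⟨by linarith, by linarith⟩
    calc (f y + f x) ^ 2 = |f y + f x| ^ 2 := (sq_abs _).symm
      _ ≤ (2 * B) ^ 2 := by gcongr
      _ = _ := by ring
  calc (f y ^ 2 - f x ^ 2) ^ 2 = (f y + f x) ^ 2 * (f y - f x) ^ 2 := by ring
    _ ≤ 4 * B ^ 2 * (f y - f x) ^ 2 := by gcongr
    _ = _ := by ring

theorem mem_mul (h : IsFormDensity E p) (hf : Measurable f) (hφ : Measurable φ)
    (hfm : E.Mem f) (hφm : E.Mem φ) {B B' : ℝ}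
    (hB : ∀ x, |f x| ≤ B) (hB' : ∀ x, |φ x| ≤ B') : E.Mem (fun x => f x * φ x) := by
  have hφ2 := ((h.mem_iff φ).1 hφm).1
  have hL : MemLp (fun x => f x * φ x) 2 μ := by
    refine (hφ2.const_mul B).mono (hf.mul hφ).aestronglyMeasurable (ae_of_all _ fun x => ?_)
    rw [norm_mul, norm_mul]
    refine mul_le_mul_of_nonneg_right ((hB x).trans (le_abs_self _)) (norm_nonneg _)
  refine h.mem_of_sq_le hfm hφm hL (a := 2 * B' ^ 2) (b := 2 * B ^ 2) (by positivity)
    (by positivity) fun x y => ?_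
  have h1 : φ y ^ 2 ≤ B' ^ 2 := sq_le_sq.2 ((hB' y).trans (le_abs_self _))
  have h2 : f x ^ 2 ≤ B ^ 2 := sq_le_sq.2 ((hB x).trans (le_abs_self _))
  calc (f y * φ y - f x * φ x) ^ 2
      = ((f y - f x) * φ y + f x * (φ y - φ x)) ^ 2 := by ring
    _ ≤ 2 * (φ y ^ 2 * (f y - f x) ^ 2) + 2 * (f x ^ 2 * (φ y - φ x) ^ 2) := by
        nlinarith [sq_nonneg ((f y - f x) * φ y - f x * (φ y - φ x))]
    _ ≤ 2 * (B' ^ 2 * (f y - f x) ^ 2) + 2 * (B ^ 2 * (φ y - φ x) ^ 2) := by gcongr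
    _ = _ := by ring

theorem tendsto_integral_of_mem (h : IsFormDensity E p) (hf : Measurable f) (hφ : Measurable φ)
    (hfm : E.Mem f) (hφm : E.Mem φ) {B B' : ℝ}
    (hB : ∀ x, |f x| ≤ B) (hB' : ∀ x, |φ x| ≤ B') :
    Tendsto (fun t => ∫ x, φ x ∂(approxEnergyMeasure μ p f t)) (𝓝[>] 0)
      (𝓝 (E.val (fun x => f x * φ x) f - 1 / 2 * E.val φ (fun x => f x ^ 2))) := by
  have hsq := h.mem_sq hf hfm hB
  have hmul := h.mem_mul hf hφ hfm hφm hB hB'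
  refine ((h.tendsto_val _ _ hmul hfm).sub
    ((h.tendsto_val _ _ hφm hsq).const_mul (1 / 2))).congr' ?_
  filter_upwards [self_mem_nhdsWithin] with t ht
  exact (integral_approxEnergyMeasure_eq_approxForm h.density ht hf hφ ((h.mem_iff f).1 hfm).1
    ((h.mem_iff φ).1 hφm).1 ((h.mem_iff _).1 hsq).1 ((h.mem_iff _).1 hmul).1 hB').symm

theorem exists_bound_univ (h : IsFormDensity E p) (hfm : E.Mem f) :
    ∃ G : ℝ, 0 ≤ G ∧ ∀ t : ℝ, 0 < t → approxEnergyMeasure μ p f t univ ≤ ENNReal.ofReal G := by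
  obtain ⟨hf2, G, hG⟩ := (h.mem_iff f).1 hfm
  refine ⟨max G 0, le_max_right _ _, fun t ht => ?_⟩
  rw [approxEnergyMeasure_univ h.density ht hf2]
  exact ENNReal.ofReal_le_ofReal ((hG t ht).trans (le_max_left _ _))

/-- For test functions in the domain the limit is known. Regularity approximates `φ` uniformly by
such functions, and the uniform bound `G` on the masses transfers the Cauchy property. -/
theorem exists_tendsto_integral (h : IsFormDensity E p) (hreg : E.IsRegular) (hf : Measurable f)
    (hfm : E.Mem f) {B : ℝ} (hB : ∀ x, |f x| ≤ B) (hφ : Continuous φ) (hφc : HasCompactSupport φ) :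
    ∃ l : ℝ, Tendsto (fun t => ∫ x, φ x ∂(approxEnergyMeasure μ p f t)) (𝓝[>] 0) (𝓝 l) := by
  obtain ⟨G, hG0, hG⟩ := h.exists_bound_univ hfm
  have hfin : ∀ t : ℝ, 0 < t → IsFiniteMeasure (approxEnergyMeasure μ p f t) := fun t ht =>
    ⟨(hG t ht).trans_lt ENNReal.ofReal_lt_top⟩
  have hcau : Cauchy (map (fun t => ∫ x, φ x ∂(approxEnergyMeasure μ p f t)) (𝓝[>] (0 : ℝ))) := by
    rw [Metric.cauchy_iff]
    refine ⟨inferInstance, fun ε hε => ?_⟩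
    -- Chosen so that the approximation error `η * G` is at most `ε / 4`; the `1` covers the case `G
    -- = 0`.
    set η := ε / (4 * (G + 1)) with hη
    have hη0 : 0 < η := by positivity
    obtain ⟨ψ, hψ, hψc, hψm, hd⟩ := hreg.dense_continuous φ hφ hφc η hη0
    obtain ⟨B', hB'⟩ := hψc.exists_bound_of_continuous hψ
    have hlim := h.tendsto_integral_of_mem hf hψ.measurable hfm hψm hB hB'
    set l := E.val (fun x => f x * ψ x) f - 1 / 2 * E.val ψ (fun x => f x ^ 2)
    have hev : ∀ᶠ t in 𝓝[>] (0 : ℝ), dist (∫ x, φ x ∂(approxEnergyMeasure μ p f t)) l < ε / 2 := by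
      filter_upwards [hlim.eventually (Metric.ball_mem_nhds l (by positivity : 0 < ε / 4)),
        self_mem_nhdsWithin] with t ht ht0
      have := hfin t ht0
      have h1 : dist (∫ x, φ x ∂(approxEnergyMeasure μ p f t))
          (∫ x, ψ x ∂(approxEnergyMeasure μ p f t)) ≤ η * G := by
        rw [dist_eq_norm, ← integral_sub (hφ.integrable_of_hasCompactSupport hφc)
          (hψ.integrable_of_hasCompactSupport hψc)]
        refine (norm_integral_le_of_norm_le_const (ae_of_all _ fun x => (hd x).le)).trans ?_
        gcongr
        exact ENNReal.toReal_le_of_le_ofReal hG0 (hG t ht0)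
      have h2 : η * G ≤ ε / 4 := by
        rw [hη, div_mul_eq_mul_div, div_le_div_iff₀ (by positivity) (by positivity)]
        nlinarith
      have h3 : dist (∫ x, ψ x ∂(approxEnergyMeasure μ p f t)) l < ε / 4 := ht
      linarith [dist_triangle (∫ x, φ x ∂(approxEnergyMeasure μ p f t))
        (∫ x, ψ x ∂(approxEnergyMeasure μ p f t)) l]
    refine ⟨Metric.ball l (ε / 2), hev, fun x hx y hy => ?_⟩
    linarith [dist_triangle_right x y l, Metric.mem_ball.1 hx, Metric.mem_ball.1 hy]
  exact CompleteSpace.complete hcau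

/-- The limits define a positive linear functional on `C_c(X)`, to which the Riesz-Markov-Kakutani
theorem applies. -/
theorem exists_limit_measure [LocallyCompactSpace X] (h : IsFormDensity E p) (hreg : E.IsRegular)
    (hf : Measurable f) (hfm : E.Mem f) {B : ℝ} (hB : ∀ x, |f x| ≤ B) :
    ∃ ν : Measure X, ν.Regular ∧ ∀ φ : X → ℝ, Continuous φ → HasCompactSupport φ →
      Tendsto (fun t => ∫ x, φ x ∂(approxEnergyMeasure μ p f t)) (𝓝[>] 0) (𝓝 (∫ x, φ x ∂ν)) := by
  obtain ⟨G, hG0, hG⟩ := h.exists_bound_univ hfm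
  have hfin : ∀ t : ℝ, 0 < t → IsFiniteMeasure (approxEnergyMeasure μ p f t) := fun t ht =>
    ⟨(hG t ht).trans_lt ENNReal.ofReal_lt_top⟩
  have hex : ∀ φ : CompactlySupportedContinuousMap X ℝ, ∃ l : ℝ,
      Tendsto (fun t => ∫ x, φ x ∂(approxEnergyMeasure μ p f t)) (𝓝[>] 0) (𝓝 l) := fun φ =>
    h.exists_tendsto_integral hreg hf hfm hB φ.continuous φ.hasCompactSupport
  choose Λ hΛ using hex
  let Λ' : CompactlySupportedContinuousMap X ℝ →ₗ[ℝ] ℝ :=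
    { toFun := Λ
      map_add' := fun φ ψ => by
        refine tendsto_nhds_unique (hΛ (φ + ψ)) (((hΛ φ).add (hΛ ψ)).congr' ?_)
        filter_upwards [self_mem_nhdsWithin] with t ht
        have := hfin t ht
        exact (integral_add (φ.continuous.integrable_of_hasCompactSupport φ.hasCompactSupport)
          (ψ.continuous.integrable_of_hasCompactSupport ψ.hasCompactSupport)).symm
      map_smul' := fun c φ => by
        refine tendsto_nhds_unique (hΛ (c • φ)) (((hΛ φ).const_mul c).congr fun t => ?_)
        exact (integral_const_mul c _).symm }
  let Λp := PositiveLinearMap.mk₀ Λ' fun φ hφ =>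
    ge_of_tendsto' (hΛ φ) fun t => integral_nonneg fun x => CompactlySupportedContinuousMap.le_def.1 hφ x
  refine ⟨RealRMK.rieszMeasure Λp, inferInstance, fun φ hφ hφc => ?_⟩
  have h1 := RealRMK.integral_rieszMeasure Λp ⟨⟨φ, hφ⟩, hφc⟩
  have h2 := hΛ ⟨⟨φ, hφ⟩, hφc⟩
  have h3 : Λp ⟨⟨φ, hφ⟩, hφc⟩ = Λ ⟨⟨φ, hφ⟩, hφc⟩ := rfl
  rw [← h3, ← h1] at h2
  exact h2

theorem isEnergyMeasure (h : IsFormDensity E p) (hf : Measurable f) (hfm : E.Mem f) {B : ℝ}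
    (hB : ∀ x, |f x| ≤ B) {ν : Measure X} (hν : ν.Regular)
    (hlim : ∀ φ : X → ℝ, Continuous φ → HasCompactSupport φ →
      Tendsto (fun t => ∫ x, φ x ∂(approxEnergyMeasure μ p f t)) (𝓝[>] 0) (𝓝 (∫ x, φ x ∂ν))) :
    E.IsEnergyMeasure f ν := by
  refine ⟨hν, hfm, memLp_top_of_bound hf.aestronglyMeasurable B (ae_of_all _ hB),
    h.mem_sq hf hfm hB, fun φ hφ hφc hφm => ?_, fun φ hφ hφc hφm => ?_⟩
  · obtain ⟨B', hB'⟩ := hφc.exists_bound_of_continuous hφ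
    exact h.mem_mul hf hφ.measurable hfm hφm hB hB'
  · obtain ⟨B', hB'⟩ := hφc.exists_bound_of_continuous hφ
    exact tendsto_nhds_unique (hlim φ hφ hφc)
      (h.tendsto_integral_of_mem hf hφ.measurable hfm hφm hB hB')

end IsFormDensity

/-- Soft thresholding is a contraction of the real line. -/
theorem sq_softThreshold_sub_le {ε : ℝ} (hε : 0 ≤ ε) (a b : ℝ) :
    ((a - max (-ε) (min ε a)) - (b - max (-ε) (min ε b))) ^ 2 ≤ (a - b) ^ 2 := by
  rw [sq_le_sq]
  grind

/-- If `ψ` is within `ε` of `φ`, its soft threshold at level `ε` vanishes wherever `φ` does, and it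
stays in the domain. -/
theorem IsFormDensity.mem_softThreshold (h : IsFormDensity E p) {ψ : X → ℝ} (hψ : Continuous ψ)
    (hψm : E.Mem ψ) {ε : ℝ} (hε : 0 ≤ ε) : E.Mem (fun x => ψ x - max (-ε) (min ε (ψ x))) := by
  have hψ2 := ((h.mem_iff ψ).1 hψm).1
  have hc : Continuous (fun x => ψ x - max (-ε) (min ε (ψ x))) := by fun_prop
  have hL : MemLp (fun x => ψ x - max (-ε) (min ε (ψ x))) 2 μ := by
    refine hψ2.mono hc.measurable.aestronglyMeasurable (ae_of_all _ fun x => ?_)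
    have := sq_softThreshold_sub_le hε (ψ x) 0
    rw [sq_le_sq] at this
    simpa [hε] using this
  refine h.mem_of_sq_le hψm hψm hL zero_le_one le_rfl fun x y => ?_
  have := sq_softThreshold_sub_le hε (ψ y) (ψ x)
  linarith

/-- Two energy measures agree on `F ∩ C_c`. To conclude by density without assuming finite total
mass, the approximants of `φ` must be supported in the fixed compact set `tsupport φ`; soft
thresholding achieves this at the cost of doubling the error. -/
theorem IsFormDensity.energyMeasure_unique [LocallyCompactSpace X] (h : IsFormDensity E p)
    (hreg : E.IsRegular) {ν ν' : Measure X} (hν : E.IsEnergyMeasure f ν)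
    (hν' : E.IsEnergyMeasure f ν') : ν' = ν := by
  have := hν.radon
  have := hν'.radon
  refine Measure.ext_of_integral_eq_on_compactlySupported fun φ => ?_
  have hφ : Continuous φ := map_continuous φ
  have hφc := φ.hasCompactSupport
  set S := tsupport φ
  have hS : IsCompact S := hφc
  have key : ∀ ε : ℝ, 0 < ε → |∫ x, φ x ∂ν' - ∫ x, φ x ∂ν| ≤
      2 * ε * ((ν' S).toReal + (ν S).toReal) := by
    intro ε hε
    obtain ⟨ψ, hψ, hψc, hψm, hd⟩ := hreg.dense_continuous φ hφ hφc ε hε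
    set χ : X → ℝ := fun x => ψ x - max (-ε) (min ε (ψ x)) with hχdef
    have hχ : Continuous χ := by fun_prop
    have hχm : E.Mem χ := h.mem_softThreshold hψ hψm hε.le
    have hoff : ∀ x, x ∉ S → χ x = 0 := by
      intro x hx
      have h0 : φ x = 0 := image_eq_zero_of_notMem_tsupport hx
      have h1 := hd x
      rw [h0, zero_sub, abs_neg, abs_lt] at h1
      simp only [hχdef]
      rw [min_eq_right h1.2.le, max_eq_right h1.1.le, sub_self]
    have hχc : HasCompactSupport χ := HasCompactSupport.intro hS hoff
    have hclose : ∀ x, |φ x - χ x| ≤ 2 * ε := by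
      intro x
      have h1 := (hd x).le
      have h2 : |max (-ε) (min ε (ψ x))| ≤ ε :=
        abs_le.2 ⟨le_max_left _ _, max_le (by linarith) (min_le_left _ _)⟩
      calc |φ x - χ x| = |(φ x - ψ x) + max (-ε) (min ε (ψ x))| := by
            simp only [hχdef]; congr 1; ring
        _ ≤ _ := (abs_add_le _ _).trans (by linarith)
    have happ : ∀ m : Measure X, IsFiniteMeasureOnCompacts m →
        |∫ x, φ x ∂m - ∫ x, χ x ∂m| ≤ 2 * ε * (m S).toReal := by
      intro m hm
      rw [← integral_sub (hφ.integrable_of_hasCompactSupport hφc)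
        (hχ.integrable_of_hasCompactSupport hχc), ← Real.norm_eq_abs,
        ← setIntegral_eq_integral_of_forall_compl_eq_zero (s := S)]
      · exact norm_setIntegral_le_of_norm_le_const hS.measure_lt_top fun x _ => hclose x
      · intro x hx
        rw [hoff x hx, image_eq_zero_of_notMem_tsupport hx, sub_zero]
    have e : ∫ x, χ x ∂ν' = ∫ x, χ x ∂ν := by
      rw [hν'.integral_eq χ hχ hχc hχm, hν.integral_eq χ hχ hχc hχm]
    have a1 := abs_le.1 (happ ν' inferInstance)
    have a2 := abs_le.1 (happ ν inferInstance)
    rw [e] at a1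
    rw [abs_le]
    constructor <;> linarith
  have hlim : Tendsto (fun ε : ℝ => 2 * ε * ((ν' S).toReal + (ν S).toReal)) (𝓝[>] 0) (𝓝 0) := by
    have : Continuous (fun ε : ℝ => 2 * ε * ((ν' S).toReal + (ν S).toReal)) := by fun_prop
    simpa using (this.tendsto 0).mono_left nhdsWithin_le_nhds
  have h0 : |∫ x, φ x ∂ν' - ∫ x, φ x ∂ν| ≤ 0 := by
    refine ge_of_tendsto hlim ?_
    filter_upwards [self_mem_nhdsWithin] with ε hε using key ε hε
  exact sub_eq_zero.1 (abs_nonpos_iff.1 h0)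

end EnergyMeasure

/-! ### BV functions, the limiting domination and Sion's measure -/

section BoundedVariation

/-- Countable subadditivity of `ν` bounds `ν K` by each cover sum, inner regularity passes to open
sets, and monotonicity gives the infimum over open supersets. -/
theorem le_mul_liminfMeasure {X : Type*} [MetricSpace X] [MeasurableSpace X] {m : ℝ → Measure X} {ν : Measure X} [ν.Regular] {c : ℝ≥0∞} (hc : c ≠ ⊤)
    (h : ∀ V : Set X, IsOpen V → ν V ≤ c * liminf (fun r => m r V) (𝓝[>] 0)) (A : Set X) :
    ν A ≤ c * liminfMeasure m A := by
  have key : ∀ K : Set X, ν K ≤ c * ⨅ (V : ℕ → Set X) (_ : ∀ i, IsOpen (V i)) (_ : K ⊆ ⋃ i, V i),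
      ∑' i, liminf (fun r : ℝ => m r (V i)) (𝓝[>] 0) := by
    intro K
    -- A zero factor cannot be moved through an infimum in `ℝ≥0∞`, since `0 * ⊤ = 0`; but for `c =
    -- 0` the hypothesis on the whole space gives `ν = 0`.
    rcases eq_or_ne c 0 with rfl | hc0
    · have h0 := h univ isOpen_univ
      rw [zero_mul] at h0 ⊢
      exact (measure_mono (subset_univ K)).trans h0
    simp only [ENNReal.mul_iInf_of_ne hc0 hc]
    refine le_iInf fun V => le_iInf fun hV => le_iInf fun hKV => ?_
    calc ν K ≤ ν (⋃ i, V i) := measure_mono hKV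
      _ ≤ ∑' i, ν (V i) := measure_iUnion_le _
      _ ≤ ∑' i, c * liminf (fun r : ℝ => m r (V i)) (𝓝[>] 0) :=
          ENNReal.tsum_le_tsum fun i => h _ (hV i)
      _ = _ := ENNReal.tsum_mul_left
  rw [liminfMeasure]
  rcases eq_or_ne c 0 with rfl | hc0
  · simpa using (key A)
  simp only [ENNReal.mul_iInf_of_ne hc0 hc]
  refine le_iInf fun U => le_iInf fun hU => le_iInf fun hAU => (measure_mono hAU).trans ?_
  rw [hU.measure_eq_iSup_isCompact]
  refine iSup_le fun K => iSup_le fun hKU => iSup_le fun hK => (key K).trans ?_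
  gcongr
  exact le_iSup_of_le K (le_iSup_of_le hK (le_iSup_of_le hKU le_rfl))

variable {X : Type*} [MetricSpace X] [MeasurableSpace X] [BorelSpace X] {μ : Measure X}
  {f : X → ℝ} {dH : ℝ}

/-- An integrable Hölder function on an Ahlfors regular space is bounded. -/
theorem exists_bound_of_holder (hμ : IsAhlforsRegular μ dH) (hf1 : ∫⁻ x, ‖f x‖ₑ ∂μ < ⊤)
    {κ H : ℝ≥0} (hH : HolderWith H κ f) : ∃ B : ℝ, ∀ x, |f x| ≤ B := by
  obtain ⟨c₁, c₂, hc₁, hc₂, hμ⟩ := hμ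
  have hT : (∫⁻ x, ‖f x‖ₑ ∂μ) / ENNReal.ofReal c₁ + H ≠ ⊤ :=
    ENNReal.add_ne_top.2 ⟨ENNReal.div_ne_top hf1.ne (ENNReal.ofReal_pos.2 hc₁).ne',
      ENNReal.coe_ne_top⟩
  refine ⟨((∫⁻ x, ‖f x‖ₑ ∂μ) / ENNReal.ofReal c₁ + H).toReal, fun x => ?_⟩
  have hb := hμ x 1 zero_lt_one
  rw [Real.one_rpow, mul_one, mul_one] at hb
  set m := μ (Metric.ball x 1)
  have hm0 : m ≠ 0 := ((ENNReal.ofReal_pos.2 hc₁).trans_le hb.1).ne'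
  have hmt : m ≠ ⊤ := (hb.2.trans_lt ENNReal.ofReal_lt_top).ne
  have h1 : ‖f x‖ₑ * m ≤ ∫⁻ y, ‖f y‖ₑ ∂μ + H * m := by
    rw [← setLIntegral_const, ← setLIntegral_const (c := (H : ℝ≥0∞))]
    refine le_trans ?_ (add_le_add (setLIntegral_le_lintegral (Metric.ball x 1) _) le_rfl)
    rw [← lintegral_add_right _ measurable_const]
    refine setLIntegral_mono' measurableSet_ball fun y hy => ?_
    have h2 : ‖f x - f y‖ₑ ≤ H := by
      rw [← edist_eq_enorm_sub]
      refine (hH x y).trans ?_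
      refine mul_le_of_le_one_right zero_le (ENNReal.rpow_le_one ?_ κ.coe_nonneg)
      rw [edist_dist, ← ENNReal.ofReal_one]
      exact ENNReal.ofReal_le_ofReal (Metric.mem_ball'.1 hy).le
    calc ‖f x‖ₑ = ‖f y + (f x - f y)‖ₑ := by congr 1; ring
      _ ≤ ‖f y‖ₑ + ‖f x - f y‖ₑ := enorm_add_le _ _
      _ ≤ _ := by gcongr
  have h3 : ‖f x‖ₑ ≤ (∫⁻ x, ‖f x‖ₑ ∂μ) / ENNReal.ofReal c₁ + H := by
    calc ‖f x‖ₑ ≤ (∫⁻ y, ‖f y‖ₑ ∂μ + H * m) / m :=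
          (ENNReal.le_div_iff_mul_le (Or.inl hm0) (Or.inl hmt)).2 h1
      _ = (∫⁻ y, ‖f y‖ₑ ∂μ) / m + H := by
          rw [ENNReal.add_div, ENNReal.mul_div_cancel_right hm0 hmt]
      _ ≤ _ := by gcongr; exact hb.1
  have h4 := ENNReal.toReal_mono hT h3
  rwa [Real.enorm_eq_ofReal_abs, ENNReal.toReal_ofReal (abs_nonneg _)] at h4

/-- The upper volume bound turns the average over `B(x, r)` into the normalisation `r^(-dH)`, so a
finite Korevaar-Schoen upper limit bounds the masses for all small `r`. -/
theorem exists_oscillationMeasure_univ_le {X : Type*} [MetricSpace X] [MeasurableSpace X]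
    {μ : Measure X} {f : X → ℝ} {dH : ℝ} (hμ : IsAhlforsRegular μ dH) {l : ℝ} (hf : MemKS μ l f) :
    ∃ G : ℝ≥0, ∀ᶠ r in 𝓝[>] (0 : ℝ), oscillationMeasure μ (dH + l) f r univ ≤ G := by
  obtain ⟨c₁, c₂, hc₁, hc₂, hμ⟩ := hμ
  obtain ⟨a, ha1, ha2⟩ := exists_between hf.2
  refine ⟨(ENNReal.ofReal c₂ * a).toNNReal, ?_⟩
  have hfin : ENNReal.ofReal c₂ * a ≠ ⊤ := ENNReal.mul_ne_top ENNReal.ofReal_ne_top ha2.ne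
  rw [ENNReal.coe_toNNReal hfin]
  filter_upwards [eventually_lt_of_limsup_lt ha1, self_mem_nhdsWithin] with r hr hr0
  have hr0 : 0 < r := hr0
  rw [oscillationMeasure, withDensity_apply _ MeasurableSet.univ, setLIntegral_univ]
  refine le_trans ?_ (mul_le_mul_right hr.le (ENNReal.ofReal c₂))
  rw [← lintegral_const_mul' _ _ ENNReal.ofReal_ne_top]
  refine lintegral_mono fun x => ?_
  rw [meanOscillation, ← lintegral_const_mul' _ _ ENNReal.ofReal_ne_top,
    ← lintegral_const_mul' _ _ ENNReal.ofReal_ne_top]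
  refine lintegral_mono fun y => ?_
  have hb := hμ x r hr0
  have hm0 : μ (Metric.ball x r) ≠ 0 :=
    ((ENNReal.ofReal_pos.2 (by positivity)).trans_le hb.1).ne'
  have hl0 : ENNReal.ofReal (r ^ l) ≠ 0 := (ENNReal.ofReal_pos.2 (by positivity)).ne'
  rw [← mul_div_assoc, ENNReal.le_div_iff_mul_le (Or.inl (mul_ne_zero hl0 hm0))
    (Or.inl (ENNReal.mul_ne_top ENNReal.ofReal_ne_top
      (hb.2.trans_lt ENNReal.ofReal_lt_top).ne))]
  calc ENNReal.ofReal (r ^ (-(dH + l))) * ‖f y - f x‖ₑ * (ENNReal.ofReal (r ^ l) * μ (Metric.ball x r))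
      ≤ ENNReal.ofReal (r ^ (-(dH + l))) * ‖f y - f x‖ₑ *
        (ENNReal.ofReal (r ^ l) * ENNReal.ofReal (c₂ * r ^ dH)) := by gcongr; exact hb.2
    _ = ENNReal.ofReal (r ^ (-(dH + l)) * (r ^ l * (c₂ * r ^ dH))) * ‖f y - f x‖ₑ := by
        rw [ENNReal.ofReal_mul (p := r ^ (-(dH + l))) (by positivity),
          ENNReal.ofReal_mul (p := r ^ l) (by positivity)]
        ring
    _ = ENNReal.ofReal c₂ * ‖f y - f x‖ₑ := by
        congr 2
        have e : r ^ (-(dH + l)) * r ^ l * r ^ dH = 1 := by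
          rw [← Real.rpow_add hr0, ← Real.rpow_add hr0,
            show -(dH + l) + l + dH = 0 by ring, Real.rpow_zero]
        linear_combination c₂ * e

theorem tendsto_rpow_nhdsGT_zero {a : ℝ} (ha : 0 < a) :
    Tendsto (fun t : ℝ => t ^ a) (𝓝[>] 0) (𝓝[>] 0) := by
  refine tendsto_nhdsWithin_iff.2 ⟨?_, ?_⟩
  · have : ContinuousAt (fun t : ℝ => t ^ a) 0 :=
      Real.continuousAt_rpow_const _ _ (Or.inr ha.le)
    have h := this.tendsto.mono_left (nhdsWithin_le_nhds (s := Ioi 0))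
    simpa [Real.zero_rpow ha.ne'] using h
  · filter_upwards [self_mem_nhdsWithin] with t ht using Real.rpow_pos_of_pos ht _

theorem tendsto_mul_nhdsGT_zero {a : ℝ} (ha : 0 < a) :
    Tendsto (fun t : ℝ => a * t) (𝓝[>] 0) (𝓝[>] 0) := by
  refine tendsto_nhdsWithin_iff.2 ⟨?_, ?_⟩
  · have : Continuous (fun t : ℝ => a * t) := by fun_prop
    have h := (this.tendsto 0).mono_left (nhdsWithin_le_nhds (s := Ioi 0))
    simpa using h
  · filter_upwards [self_mem_nhdsWithin] with t ht using mul_pos ha ht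

/-- Lipschitz cut-off functions between a compact set and an open neighbourhood. -/
theorem exists_lipschitz_cutoff {X : Type*} [MetricSpace X] [ProperSpace X] {K V : Set X} (hK : IsCompact K) (hV : IsOpen V)
    (hKV : K ⊆ V) : ∃ (φ : X → ℝ≥0) (L : ℝ≥0), LipschitzWith L φ ∧ (∀ x, φ x ≤ 1) ∧
      (∀ x ∈ K, φ x = 1) ∧ (∀ x, x ∉ V → φ x = 0) ∧ HasCompactSupport φ := by
  obtain ⟨δ, hδ, hδV⟩ := hK.exists_cthickening_subset_open hV hKV
  refine ⟨thickenedIndicator hδ K, _, lipschitzWith_thickenedIndicator hδ K,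
    thickenedIndicator_le_one hδ K, fun x hx => thickenedIndicator_one hδ K hx, fun x hx => ?_, ?_⟩
  · exact thickenedIndicator_zero hδ K fun h => hx (hδV (Metric.thickening_subset_cthickening δ K h))
  · exact HasCompactSupport.intro (hK.cthickening (r := δ)) fun x hx =>
      thickenedIndicator_zero hδ K fun h => hx (Metric.thickening_subset_cthickening δ K h)

variable {p : ℝ → X → X → ℝ}

/-- The approximating energy measures of `f` are dominated by the oscillation measures of `f`,
up to a constant and an error that vanishes as `t → 0`. -/
def EnergyDomination (μ : Measure X) (p : ℝ → X → X → ℝ) (s dW : ℝ) (f : X → ℝ) (A D : ℝ)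
    (c : ℝ≥0∞) : Prop :=
  ∀ (φ : X → ℝ≥0) (L : ℝ≥0), LipschitzWith L φ → (∀ x, φ x ≤ 1) → ∀ t : ℝ, 0 < t →
    ∫⁻ x, φ x ∂(approxEnergyMeasure μ p f t) ≤ c *
      (∫⁻ x, φ x ∂(oscillationMeasure μ s f ((A * t) ^ (1 / dW))) +
        L * ENNReal.ofReal (D * t ^ (1 / dW)) *
          oscillationMeasure μ s f ((A * t) ^ (1 / dW)) univ)

/-- In the limit, the energy measure is dominated by the oscillation measures along every filter
that converges to `0` from the right. -/
theorem EnergyDomination.lintegral_le {s dW A D : ℝ} {c : ℝ≥0∞}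
    (hdom : EnergyDomination μ p s dW f A D c) (hdW : 0 < dW) (hA : 0 < A) (hc : c ≠ ⊤)
    (hfin : ∀ t : ℝ, 0 < t → IsFiniteMeasure (approxEnergyMeasure μ p f t)) {G : ℝ≥0}
    (hG : ∀ᶠ r in 𝓝[>] (0 : ℝ), oscillationMeasure μ s f r univ ≤ G)
    {ν : Measure X} [IsFiniteMeasureOnCompacts ν]
    (hlim : ∀ φ : X → ℝ, Continuous φ → HasCompactSupport φ →
      Tendsto (fun t => ∫ x, φ x ∂(approxEnergyMeasure μ p f t)) (𝓝[>] 0) (𝓝 (∫ x, φ x ∂ν)))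
    {φ : X → ℝ≥0} {L : ℝ≥0} (hL : LipschitzWith L φ) (hφ1 : ∀ x, φ x ≤ 1)
    (hφc : HasCompactSupport φ) {F : Filter ℝ} [F.NeBot] (hF : F ≤ 𝓝[>] 0) :
    ∫⁻ x, φ x ∂ν ≤ c * liminf (fun r => ∫⁻ x, φ x ∂(oscillationMeasure μ s f r)) F := by
  have hφr : Continuous (fun x => (φ x : ℝ)) := NNReal.continuous_coe.comp hL.continuous
  have hφrc : HasCompactSupport (fun x => (φ x : ℝ)) :=
    hφc.comp_left (g := fun y : ℝ≥0 => (y : ℝ)) NNReal.coe_zero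
  have hof : ∀ m : Measure X, IsFiniteMeasureOnCompacts m →
      ENNReal.ofReal (∫ x, (φ x : ℝ) ∂m) = ∫⁻ x, φ x ∂m := by
    intro m hm
    rw [ofReal_integral_eq_lintegral_ofReal (hφr.integrable_of_hasCompactSupport hφrc)
      (ae_of_all _ fun x => (φ x).coe_nonneg)]
    simp only [ENNReal.ofReal_coe_nnreal]
  have hlim1 : Tendsto (fun t => ∫⁻ x, φ x ∂(approxEnergyMeasure μ p f t)) (𝓝[>] 0)
      (𝓝 (∫⁻ x, φ x ∂ν)) := by
    rw [← hof ν inferInstance]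
    refine (ENNReal.tendsto_ofReal (hlim _ hφr hφrc)).congr' ?_
    filter_upwards [self_mem_nhdsWithin] with t ht
    have := hfin t ht
    exact hof _ inferInstance
  -- The time `t = A⁻¹ r^dW` is the one for which the radius `(A t)^(1/dW)` equals `r`.
  have htime : Tendsto (fun r : ℝ => A⁻¹ * r ^ dW) F (𝓝[>] 0) :=
    ((tendsto_mul_nhdsGT_zero (inv_pos.2 hA)).comp (tendsto_rpow_nhdsGT_zero hdW)).mono_left hF
  have hlim2 := hlim1.comp htime
  have hpos : ∀ᶠ r in F, (0 : ℝ) < r := hF self_mem_nhdsWithin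
  -- The error caused by the spreading of the cut-off, with the mass replaced by its bound `G`; it
  -- tends to `0` for fixed `L`.
  set e : ℝ → ℝ≥0∞ := fun r => L * ENNReal.ofReal (D * (A⁻¹ * r ^ dW) ^ (1 / dW)) * G with he
  have hbound : ∀ᶠ r in F, ∫⁻ x, φ x ∂(approxEnergyMeasure μ p f (A⁻¹ * r ^ dW)) ≤
      c * (∫⁻ x, φ x ∂(oscillationMeasure μ s f r) + e r) := by
    filter_upwards [hpos, hF hG] with r hr hGr
    have h1 := hdom φ L hL hφ1 (A⁻¹ * r ^ dW) (by positivity)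
    have h2 : (A * (A⁻¹ * r ^ dW)) ^ (1 / dW) = r := by
      rw [mul_inv_cancel_left₀ hA.ne', ← Real.rpow_mul hr.le, mul_one_div_cancel hdW.ne',
        Real.rpow_one]
    rw [h2] at h1
    refine h1.trans ?_
    simp only [he]
    gcongr
  have he0 : Tendsto e F (𝓝 0) := by
    have h1 : Tendsto (fun r : ℝ => (A⁻¹ * r ^ dW) ^ (1 / dW)) F (𝓝 0) :=
      ((tendsto_rpow_nhdsGT_zero (one_div_pos.2 hdW)).comp htime).mono_right nhdsWithin_le_nhds
    have h2 := ENNReal.tendsto_ofReal (h1.const_mul D)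
    rw [mul_zero, ENNReal.ofReal_zero] at h2
    have h3 := ENNReal.Tendsto.mul_const (ENNReal.Tendsto.const_mul h2
      (Or.inr (ENNReal.coe_ne_top (r := L)))) (Or.inr (ENNReal.coe_ne_top (r := G)))
    rwa [mul_zero, zero_mul] at h3
  calc ∫⁻ x, φ x ∂ν
      = liminf (fun r => ∫⁻ x, φ x ∂(approxEnergyMeasure μ p f (A⁻¹ * r ^ dW))) F :=
        hlim2.liminf_eq.symm
    _ ≤ liminf (fun r => c * (∫⁻ x, φ x ∂(oscillationMeasure μ s f r) + e r)) F :=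
        liminf_le_liminf hbound
    _ = _ := by
        rw [ENNReal.liminf_const_mul_of_ne_top hc]
        congr 1
        exact ENNReal.liminf_add_of_right_tendsto_zero he0 _

variable [SecondCountableTopology X] [SigmaFinite μ] {E : DirichletForm μ}

/-- The domain criterion asks for a bound at all times. Away from `0` it is automatic: `(a - b)² ≤ 2
a² + 2 b²` and the marginals bound the approximating form by `2 ‖f‖₂² / t`. -/
theorem IsFormDensity.mem_of_eventually_le (h : IsFormDensity E p) (hf2 : MemLp f 2 μ) {G : ℝ}
    (hG : ∀ᶠ t in 𝓝[>] (0 : ℝ), approxForm μ p t f f ≤ G) : E.Mem f := by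
  obtain ⟨t₀, ht₀, hG⟩ := mem_nhdsGT_iff_exists_Ioo_subset.1 hG
  have ht₀ : 0 < t₀ := ht₀
  set N := ∫ x, f x ^ 2 ∂μ with hN
  have hN0 : 0 ≤ N := integral_nonneg fun x => sq_nonneg _
  refine (h.mem_iff f).2 ⟨hf2, max G (2 * N / t₀), fun t ht => ?_⟩
  rcases lt_or_ge t t₀ with hlt | hge
  · exact (hG ⟨ht, hlt⟩).trans (le_max_left _ _)
  refine le_trans ?_ (le_max_right _ _)
  have hd := h.density
  have i1 : Integrable (fun q : X × X => f q.1 ^ 2) (jointMeasure μ p t) :=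
    (hf2.comp_measurePreserving (hd.measurePreserving_fst ht)).integrable_sq
  have i2 : Integrable (fun q : X × X => f q.2 ^ 2) (jointMeasure μ p t) :=
    (hf2.comp_measurePreserving (hd.measurePreserving_snd ht)).integrable_sq
  have e1 : ∫ q, f q.1 ^ 2 ∂(jointMeasure μ p t) = N := by
    have hm := hd.measurePreserving_fst ht
    have := integral_map (φ := Prod.fst) (μ := jointMeasure μ p t) (f := fun x => f x ^ 2)
      hm.measurable.aemeasurable (hm.map_eq.symm ▸ hf2.1.pow 2)
    rw [hm.map_eq] at this
    exact this.symm
  have e2 : ∫ q, f q.2 ^ 2 ∂(jointMeasure μ p t) = N := by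
    rw [← e1, ← hd.integral_joint_swap ht]
    rfl
  have hle : ∫ q, (f q.2 - f q.1) * (f q.2 - f q.1) ∂(jointMeasure μ p t) ≤ 4 * N := by
    calc _ ≤ ∫ q, (2 * f q.2 ^ 2 + 2 * f q.1 ^ 2) ∂(jointMeasure μ p t) := by
          refine integral_mono (hd.integrable_sub_mul_sub ht hf2 hf2)
            ((i2.const_mul 2).add (i1.const_mul 2)) fun q => ?_
          simp only
          nlinarith [sq_nonneg (f q.2 + f q.1)]
      _ = 4 * N := by
          rw [integral_add (i2.const_mul 2) (i1.const_mul 2), integral_const_mul,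
            integral_const_mul, e1, e2]
          ring
  calc approxForm μ p t f f ≤ (2 * t)⁻¹ * (4 * N) :=
        mul_le_mul_of_nonneg_left hle (by positivity)
    _ = 2 * N / t := by field_simp; norm_num
    _ ≤ 2 * N / t₀ := by gcongr

theorem exists_energyDomination (h : IsTransitionDensity μ p) {dW c₃ c₄ c₅ c₆ : ℝ}
    (hb : PointwiseBounds p dH dW c₃ c₄ c₅ c₆) (hdW : 2 ≤ dW) {κ : ℝ≥0} (hκ : 0 < κ) :
    ∃ (A : ℝ) (C : ℝ≥0) (D : ℝ), 0 < A ∧ 0 < C ∧ 0 < D ∧ ∀ (f : X → ℝ) (H : ℝ≥0),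
      HolderWith H κ f → ∫⁻ x, ‖f x‖ₑ ∂μ < ⊤ →
      EnergyDomination μ p (dH + dW - κ) dW f A D (C * H) := by
  obtain ⟨A, C, D, hA, hC, hD, key⟩ := exists_lintegral_heatEnergy_le h hb hdW hκ
  refine ⟨A, C, D, hA, hC, hD, fun f H hH hf1 φ L hL hφ1 t ht => ?_⟩
  have hφm : Measurable (fun x => (φ x : ℝ≥0∞)) := hL.continuous.measurable.coe_nnreal_ennreal
  rw [lintegral_approxEnergyMeasure h ht (hH.continuous hκ).measurable hφm]
  refine (mul_le_mul_right (key f H hH hf1 φ L hL hφ1 t ht) _).trans ?_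
  rw [← mul_assoc, ← ENNReal.ofReal_mul (by positivity)]
  refine mul_le_of_le_one_left zero_le ?_
  rw [ENNReal.ofReal_le_one, mul_inv, mul_assoc, inv_mul_cancel₀ ht.ne']
  norm_num

/-- Take the weight `φ = 1` with `L = 0`: the error term disappears and the left side is the
approximating form of `f`. -/
theorem EnergyDomination.mem {s dW A D : ℝ} {c : ℝ≥0∞} (hdom : EnergyDomination μ p s dW f A D c)
    (h : IsFormDensity E p) (hdW : 0 < dW) (hA : 0 < A) (hc : c ≠ ⊤)
    (hf2 : MemLp f 2 μ) {G : ℝ≥0}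
    (hG : ∀ᶠ r in 𝓝[>] (0 : ℝ), oscillationMeasure μ s f r univ ≤ G) : E.Mem f := by
  refine h.mem_of_eventually_le hf2 (G := (c * G).toReal) ?_
  have hr : Tendsto (fun t : ℝ => (A * t) ^ (1 / dW)) (𝓝[>] 0) (𝓝[>] 0) :=
    (tendsto_rpow_nhdsGT_zero (one_div_pos.2 hdW)).comp (tendsto_mul_nhdsGT_zero hA)
  filter_upwards [hr.eventually hG, self_mem_nhdsWithin] with t ht ht0
  have h1 := hdom (fun _ => 1) 0 (LipschitzWith.const 1) (fun _ => le_rfl) t ht0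
  simp only [ENNReal.coe_one, lintegral_one, ENNReal.coe_zero, zero_mul, add_zero] at h1
  rw [approxEnergyMeasure_univ h.density ht0 hf2] at h1
  have h2 := h1.trans (mul_le_mul_right ht c)
  exact (ENNReal.ofReal_le_iff_le_toReal (ENNReal.mul_ne_top hc ENNReal.coe_ne_top)).1 h2

end BoundedVariation

/-! ### From cut-off functions to open sets and null sets -/

section Domination

variable {X : Type*} [MetricSpace X] [ProperSpace X] [MeasurableSpace X] [BorelSpace X]
  {μ : Measure X} {f : X → ℝ}

/-- If the integral against `ν` of every Lipschitz cut-off function is bounded by the lower limit of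
its integrals against `m r`, then the same is true for the measures of open sets. -/
theorem measure_le_liminf_of_cutoff {m : ℝ → Measure X} {ν : Measure X} [ν.Regular] {c : ℝ≥0∞}
    {F : Filter ℝ}
    (h : ∀ (φ : X → ℝ≥0) (L : ℝ≥0), LipschitzWith L φ → (∀ x, φ x ≤ 1) → HasCompactSupport φ →
      ∫⁻ x, φ x ∂ν ≤ c * liminf (fun r => ∫⁻ x, φ x ∂(m r)) F) {V : Set X} (hV : IsOpen V) :
    ν V ≤ c * liminf (fun r => m r V) F := by
  rw [hV.measure_eq_iSup_isCompact]
  refine iSup_le fun K => iSup_le fun hKV => iSup_le fun hK => ?_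
  obtain ⟨φ, L, hL, hφ1, hφK, hφV, hφc⟩ := exists_lipschitz_cutoff hK hV hKV
  calc ν K = ∫⁻ _ in K, 1 ∂ν := by rw [setLIntegral_one]
    _ ≤ ∫⁻ x in K, φ x ∂ν :=
        setLIntegral_mono' hK.measurableSet fun x hx => by rw [hφK x hx, ENNReal.coe_one]
    _ ≤ ∫⁻ x, φ x ∂ν := setLIntegral_le_lintegral _ _
    _ ≤ c * liminf (fun r => ∫⁻ x, φ x ∂(m r)) F := h φ L hL hφ1 hφc
    _ ≤ _ := by
        refine mul_le_mul_right (liminf_le_liminf (Eventually.of_forall fun r => ?_)) _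
        rw [← lintegral_indicator_one hV.measurableSet]
        refine lintegral_mono fun x => ?_
        by_cases hx : x ∈ V
        · simpa [hx] using hφ1 x
        · simp [hx, hφV x hx]

/-- A measure dominated by the oscillation measures of `f` along every sequence of radii is
absolutely continuous with respect to the BV measures of `f`. -/
theorem IsBVMeasure.absolutelyContinuous {s : ℝ} {γ : Measure X} (hγ : IsBVMeasure μ s f γ)
    {ν : Measure X} [ν.Regular] {c : ℝ≥0∞} (hc : c ≠ ⊤) {G : ℝ≥0}
    (hG : ∀ᶠ r in 𝓝[>] (0 : ℝ), oscillationMeasure μ s f r univ ≤ G)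
    (h : ∀ (φ : X → ℝ≥0) (L : ℝ≥0), LipschitzWith L φ → (∀ x, φ x ≤ 1) → HasCompactSupport φ →
      ∀ F : Filter ℝ, F.NeBot → F ≤ 𝓝[>] 0 →
      ∫⁻ x, φ x ∂ν ≤ c * liminf (fun r => ∫⁻ x, φ x ∂(oscillationMeasure μ s f r)) F) :
    ν ≪ γ := by
  obtain ⟨hreg, r, hr0, -, hr, hlim⟩ := hγ
  have hr' : Tendsto r atTop (𝓝[>] 0) :=
    tendsto_nhdsWithin_iff.2 ⟨hr, Eventually.of_forall hr0⟩
  have hφγ : ∀ (φ : X → ℝ≥0) (L : ℝ≥0), LipschitzWith L φ → (∀ x, φ x ≤ 1) → HasCompactSupport φ →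
      ∫⁻ x, φ x ∂ν ≤ c * ∫⁻ x, φ x ∂γ := by
    intro φ L hL hφ1 hφc
    have hφr : Continuous (fun x => (φ x : ℝ)) := NNReal.continuous_coe.comp hL.continuous
    have hφrc : HasCompactSupport (fun x => (φ x : ℝ)) :=
      hφc.comp_left (g := fun y : ℝ≥0 => (y : ℝ)) NNReal.coe_zero
    have hof : ∀ m : Measure X, IsFiniteMeasureOnCompacts m →
        ENNReal.ofReal (∫ x, (φ x : ℝ) ∂m) = ∫⁻ x, φ x ∂m := by
      intro m hm
      rw [ofReal_integral_eq_lintegral_ofReal (hφr.integrable_of_hasCompactSupport hφrc)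
        (ae_of_all _ fun x => (φ x).coe_nonneg)]
      simp only [ENNReal.ofReal_coe_nnreal]
    let g : ZeroAtInftyContinuousMap X ℝ :=
      ⟨⟨fun x => (φ x : ℝ), hφr⟩, hφrc.is_zero_at_infty⟩
    have h1 : Tendsto (fun n => ∫⁻ x, φ x ∂(oscillationMeasure μ s f (r n))) atTop
        (𝓝 (∫⁻ x, φ x ∂γ)) := by
      rw [← hof γ inferInstance]
      refine (ENNReal.tendsto_ofReal (hlim g)).congr' ?_
      filter_upwards [hr'.eventually hG] with n hn
      have : IsFiniteMeasure (oscillationMeasure μ s f (r n)) :=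
        ⟨hn.trans_lt ENNReal.coe_lt_top⟩
      exact hof _ inferInstance
    -- Along the filter generated by the radii that define `γ`, the lower limit is a limit, namely
    -- the integral against `γ`.
    have h2 := h φ L hL hφ1 hφc (map r atTop) inferInstance hr'
    have h3 : liminf (fun r => ∫⁻ x, φ x ∂(oscillationMeasure μ s f r)) (map r atTop) =
        ∫⁻ x, φ x ∂γ := h1.liminf_eq
    rwa [h3] at h2
  have hopen : ∀ V : Set X, IsOpen V → ν V ≤ c * γ V := by
    intro V hV
    -- For the constant family `γ` the lower limit is `γ` itself, whatever the filter.
    have := measure_le_liminf_of_cutoff (m := fun _ => γ) (F := 𝓝[>] (0 : ℝ)) (c := c) (ν := ν)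
      (fun φ L hL hφ1 hφc => by simpa using hφγ φ L hL hφ1 hφc) hV
    simpa using this
  refine Measure.AbsolutelyContinuous.mk fun N _ hN0 => le_antisymm ?_ zero_le
  rcases eq_or_ne c 0 with rfl | hc0
  · simpa using (measure_mono (subset_univ N)).trans (hopen univ isOpen_univ)
  -- Outer regularity of `γ` carries the bound from open sets to arbitrary sets.
  calc ν N ≤ c * γ N := by
        rw [N.measure_eq_iInf_isOpen γ]
        simp only [ENNReal.mul_iInf_of_ne hc0 hc]
        exact le_iInf fun V => le_iInf fun hNV => le_iInf fun hV =>
          (measure_mono hNV).trans (hopen V hV)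
    _ = 0 := by rw [hN0, mul_zero]

end Domination

end BVDirichlet

/-! ### The main theorem -/

theorem mainTheorem6 {X : Type*} [MetricSpace X] [ProperSpace X] [MeasurableSpace X] [BorelSpace X]
    (μ : Measure X) [μ.Regular] [μ.IsOpenPosMeasure]
    (dH dW : ℝ) (κ : ℝ≥0) (hdH : 0 < dH) (hdW : 2 ≤ dW)
    (hμ : BVDirichlet.IsAhlforsRegular μ dH)
    (E : BVDirichlet.DirichletForm μ) (hreg : E.IsRegular) (hloc : E.IsStronglyLocal)
    (p : ℝ → X → X → ℝ) (hp : E.IsContinuousHeatKernel p)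
    (hsub : BVDirichlet.SubGaussianEstimates μ p dH dW)
    (hwBE : BVDirichlet.WeakBakryEmery μ p dW κ)
    (hκ : BVDirichlet.criticalExponent μ = ((dW - κ : ℝ) : EReal)) :
    ∃ C : ℝ≥0, 0 < C ∧ ∀ f : X → ℝ,
      BVDirichlet.MemBV μ f → MemLp f 2 μ → MemHolder κ f →
        E.Mem f ∧
        ∃ ν : Measure X, E.IsEnergyMeasure f ν ∧
          (∀ ν' : Measure X, E.IsEnergyMeasure f ν' → ν' = ν) ∧
          (∀ γ : Measure X, BVDirichlet.IsBVMeasure μ (dH + dW - κ) f γ → ν ≪ γ) ∧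
          ∀ A : Set X, MeasurableSet A →
            ν A ≤ C * eHolderNorm κ f *
              BVDirichlet.liminfMeasure
                (BVDirichlet.oscillationMeasure μ (dH + dW - κ) f) A := by
  obtain ⟨hcont, P, hP, hker⟩ := hp
  obtain ⟨c₃, c₄, c₅, c₆, hb⟩ := hsub.pointwise hdW hcont
  have hd := BVDirichlet.isTransitionDensity hP hker hcont hdH hdW hμ hb hwBE
  have hE := hd.isFormDensity hP hker
  have hW : 0 < dW := by linarith
  obtain ⟨A, C, D, hA, hC, hD, key⟩ := BVDirichlet.exists_energyDomination hd hb hdW (NNReal.coe_pos.1 hwBE.1)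
  refine ⟨C, hC, fun f hBV hf2 hH => ?_⟩
  have hf1 : ∫⁻ x, ‖f x‖ₑ ∂μ < ⊤ := (memLp_one_iff_integrable.1 hBV.1).2
  have hfm : Measurable f := (hH.holderWith.continuous (NNReal.coe_pos.1 hwBE.1)).measurable
  have hdom := key f (nnHolderNorm κ f) hH.holderWith hf1
  rw [hH.coe_nnHolderNorm_eq_eHolderNorm] at hdom
  have hc : (C : ℝ≥0∞) * eHolderNorm κ f ≠ ⊤ :=
    ENNReal.mul_ne_top ENNReal.coe_ne_top (eHolderNorm_ne_top.2 hH)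
  -- With the critical exponent equal to `dW - κ`, the class `BV` is the Korevaar-Schoen class whose
  -- normalisation `dH + (dW - κ)` is that of the oscillation measures.
  rw [BVDirichlet.MemBV, hκ, EReal.toReal_coe] at hBV
  obtain ⟨G, hG⟩ := BVDirichlet.exists_oscillationMeasure_univ_le hμ hBV
  rw [← add_sub_assoc] at hG
  have hmem : E.Mem f := hdom.mem hE hW hA hc hf2 hG
  obtain ⟨B, hB⟩ := BVDirichlet.exists_bound_of_holder hμ hf1 hH.holderWith
  obtain ⟨ν, hνreg, hlim⟩ := hE.exists_limit_measure hreg hfm hmem hB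
  have hν := hE.isEnergyMeasure hfm hmem hB hνreg hlim
  obtain ⟨G', -, hG'⟩ := hE.exists_bound_univ hmem
  -- The filter is left arbitrary: sequences of radii serve the BV measures, the full limit `r → 0+`
  -- serves Sion's measure.
  have hcut : ∀ (φ : X → ℝ≥0) (L : ℝ≥0), LipschitzWith L φ → (∀ x, φ x ≤ 1) →
      HasCompactSupport φ → ∀ F : Filter ℝ, F.NeBot → F ≤ 𝓝[>] 0 →
      ∫⁻ x, φ x ∂ν ≤ C * eHolderNorm κ f *
        liminf (fun r => ∫⁻ x, φ x ∂(BVDirichlet.oscillationMeasure μ (dH + dW - κ) f r)) F :=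
    fun φ L hL hφ1 hφc F _ hF => hdom.lintegral_le hW hA hc
      (fun t ht => ⟨(hG' t ht).trans_lt ENNReal.ofReal_lt_top⟩) hG hlim hL hφ1 hφc hF
  refine ⟨hmem, ν, hν, fun ν' hν' => hE.energyMeasure_unique hreg hν hν',
    fun γ hγ => hγ.absolutelyContinuous hc hG hcut, fun A _ => ?_⟩
  exact BVDirichlet.le_mul_liminfMeasure hc (fun V hV => BVDirichlet.measure_le_liminf_of_cutoff
    (fun φ L hL hφ1 hφc => hcut φ L hL hφ1 hφc _ inferInstance le_rfl) hV) A
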